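/- Let $X$ and $Y$ be complex manifolds with $X$ compact, let $\mathcal L$ be a holomorphic line bundle on $Y\times X$, and let $\varphi:Y\to\mathrm{Pic}(X)$, $\varphi(y)=[\mathcal L|_{\{y\}\times X}]$, be the induced map to the group of isomorphism classes of holomorphic line bundles on $X$. Fix a (smooth) Hermitian metric $h$ on $\mathcal L$ and let $F_{\mathcal L,h}$ be the curvature of the Chern connection of $(\mathcal L,h)$, a $(1,1)$-form on $Y\times X$ (locally $F_{\mathcal L,h}=d\,\partial\log h(e,e)$ for a local holomorphic frame $e$). Identify $H^1(X,\mathcal O_X)$ with the Dolbeault group $H^{0,1}(X)=Z^{0,1}_{\bar\partial}(X)/\bar\partial C^\infty(X,\mathbb C)$. For a holomorphic line bundle $\mathcal N$ on $X$ and $\alpha\in Z^{0,1}_{\bar\partial}(X)$ let $\exp([\alpha])\cdot[\mathcal N]\in\mathrm{Pic}(X)$ be the class of the holomorphic line bundle defined by the integrable semiconnection $\bar\partial_{\mathcal N}+\alpha$ on the smooth line bundle underlying $\mathcal N$; the complex structure of $\mathrm{Pic}(X)$ is the one for which, for every $l\in\mathrm{Pic}(X)$, the map $c\mapsto\exp(c)\cdot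 l$ is a local biholomorphism from $H^1(X,\mathcal O_X)$ to $\mathrm{Pic}(X)$, and its differential at $0$ identifies $T_l\,\mathrm{Pic}(X)$ with $H^1(X,\mathcal O_X)$. Then $\varphi$ is complex differentiable at every point $y\in Y$, and for every tangent vector $v\in T_yY$ the $(0,1)$-part of the $1$-form $\iota_vF_{\mathcal L,h}$ on $X$, defined by $\iota_vF_{\mathcal L,h}(\xi)=F_{\mathcal L,h}((v,0),(0,\xi))$ at the points $(y,x)$, $x\in X$, $\xi\in T_xX$, is $\bar\partial$-closed and $$d\varphi(v)=\big[(\iota_vF_{\mathcal L,h})^{0,1}\big]\in H^1(X,\mathcal O_X).$$ -/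

import Mathlib

open Bundle Filter Topology
open scoped Manifold ContDiff ComplexConjugate

noncomputable section

/-! ### Holomorphic line bundles and the Picard group -/

section LineBundles

universe uE uH uM w

/-- A holomorphic line bundle on the complex manifold `M` (modelled on `I`): a rank one complex
vector bundle whose changes of trivialization are holomorphic. -/
structure HolLineBundle {E : Type uE} {H : Type uH} [NormedAddCommGroup E] [NormedSpace ℂ E]
    [TopologicalSpace H] (I : ModelWithCorners ℂ E H)
    (M : Type uM) [TopologicalSpace M] [ChartedSpace H M] where
  fiber : M → Type w
  [addCommGroup : ∀ p, AddCommGroup (fiber p)]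
  [module : ∀ p, Module ℂ (fiber p)]
  [topologicalSpaceFiber : ∀ p, TopologicalSpace (fiber p)]
  [topologicalSpaceTotal : TopologicalSpace (TotalSpace ℂ fiber)]
  [fiberBundle : FiberBundle ℂ fiber]
  [vectorBundle : VectorBundle ℂ ℂ fiber]
  [holomorphic : ContMDiffVectorBundle ω ℂ fiber I]

attribute [instance] HolLineBundle.addCommGroup HolLineBundle.module
  HolLineBundle.topologicalSpaceFiber HolLineBundle.topologicalSpaceTotal
  HolLineBundle.fiberBundle HolLineBundle.vectorBundle HolLineBundle.holomorphic

namespace HolLineBundle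

variable {E : Type uE} {H : Type uH} [NormedAddCommGroup E] [NormedSpace ℂ E] [TopologicalSpace H]
  {I : ModelWithCorners ℂ E H} {M : Type uM} [TopologicalSpace M] [ChartedSpace H M]

/-- The local holomorphic frame of `L` around `p` given by the preferred trivialization at `p`,
as a function of the point `q` near `p`. -/
def frame (L : HolLineBundle I M) (p q : M) : L.fiber q :=
  (trivializationAt ℂ L.fiber p).symm q 1

/-- The coefficient of a section `s` of `L` in the local holomorphic frame around `p`. -/
def coeff (L : HolLineBundle I M) (p : M) (s : ∀ q, L.fiber q) (q : M) : ℂ :=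
  (trivializationAt ℂ L.fiber p ⟨q, s q⟩).2

/-- A fibrewise linear isomorphism which is holomorphic in both directions. -/
def IsIso (L L' : HolLineBundle I M) : Prop :=
  ∃ f : ∀ p, L.fiber p ≃ₗ[ℂ] L'.fiber p,
    ContMDiff (I.prod 𝓘(ℂ, ℂ)) (I.prod 𝓘(ℂ, ℂ)) ω
      (fun v : TotalSpace ℂ L.fiber => (⟨v.1, f v.1 v.2⟩ : TotalSpace ℂ L'.fiber)) ∧
    ContMDiff (I.prod 𝓘(ℂ, ℂ)) (I.prod 𝓘(ℂ, ℂ)) ω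
      (fun v : TotalSpace ℂ L'.fiber => (⟨v.1, (f v.1).symm v.2⟩ : TotalSpace ℂ L.fiber))

theorem IsIso.refl (L : HolLineBundle I M) : IsIso L L :=
  ⟨fun _ => LinearEquiv.refl ℂ _, contMDiff_id, contMDiff_id⟩

theorem IsIso.symm {L L' : HolLineBundle I M} (h : IsIso L L') : IsIso L' L := by
  obtain ⟨f, h1, h2⟩ := h
  exact ⟨fun p => (f p).symm, h2, h1⟩

theorem IsIso.trans {L L' L'' : HolLineBundle I M} (h : IsIso L L') (h' : IsIso L' L'') :
    IsIso L L'' := by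
  obtain ⟨f, h1, h2⟩ := h
  obtain ⟨g, h3, h4⟩ := h'
  exact ⟨fun p => (f p).trans (g p), h3.comp h1, h2.comp h4⟩

instance setoid (I : ModelWithCorners ℂ E H) (M : Type uM) [TopologicalSpace M]
    [ChartedSpace H M] : Setoid (HolLineBundle.{uE, uH, uM, w} I M) where
  r := IsIso
  iseqv := ⟨IsIso.refl, IsIso.symm, IsIso.trans⟩

end HolLineBundle

/-- `Pic(X)`: isomorphism classes of holomorphic line bundles on the complex manifold `X`. -/
def Pic (E : Type uE) (X : Type uM) [NormedAddCommGroup E] [NormedSpace ℂ E] [TopologicalSpace X]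
    [ChartedSpace E X] : Type (max uM (w + 1)) :=
  Quotient (HolLineBundle.setoid.{uE, uE, uM, w} 𝓘(ℂ, E) X)

end LineBundles

/-! ### Families of line bundles -/

section Families

universe w

variable {EY EX Y X : Type*} [NormedAddCommGroup EY] [NormedSpace ℂ EY]
  [NormedAddCommGroup EX] [NormedSpace ℂ EX]
  [TopologicalSpace Y] [ChartedSpace EY Y] [TopologicalSpace X] [ChartedSpace EX X]

/-- The holomorphic embedding `x ↦ (y, x)` of `X` in `Y × X`. -/
def sliceMap (y : Y) : ContMDiffMap 𝓘(ℂ, EX) (𝓘(ℂ, EY).prod 𝓘(ℂ, EX)) X (Y × X) ω :=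
  ⟨fun x => (y, x), contMDiff_const.prodMk contMDiff_id⟩

/-- The line bundle `L_y` on `X`: the restriction of `L` to `{y} × X`. -/
def HolLineBundle.restrict (L : HolLineBundle.{_, _, _, w} (𝓘(ℂ, EY).prod 𝓘(ℂ, EX)) (Y × X)) (y : Y) :
    HolLineBundle.{_, _, _, w} 𝓘(ℂ, EX) X where
  fiber := (sliceMap (EY := EY) (EX := EX) (X := X) y) *ᵖ L.fiber
  addCommGroup x := inferInstanceAs (AddCommGroup (L.fiber (y, x)))
  module x := inferInstanceAs (Module ℂ (L.fiber (y, x)))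

/-- The map `Y → Pic(X)`, `y ↦ [L_y]`, induced by a line bundle `L` on `Y × X`. -/
def HolLineBundle.inducedMap (L : HolLineBundle.{_, _, _, w} (𝓘(ℂ, EY).prod 𝓘(ℂ, EX)) (Y × X)) (y : Y) :
    Pic.{_, _, w} EX X :=
  Quotient.mk (HolLineBundle.setoid 𝓘(ℂ, EX) X) (L.restrict y)

end Families

/-! ### The Dolbeault group `H^{0,1}(X) = H¹(X, 𝒪_X)` -/

section Dolbeault

variable {E X : Type*} [NormedAddCommGroup E] [NormedSpace ℂ E] [TopologicalSpace X]
  [ChartedSpace E X]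

variable (E) in
/-- The real differential `df_x` of a complex valued function on `X`. -/
def realDiff (f : X → ℂ) (x : X) : E →L[ℝ] ℂ :=
  mfderiv 𝓘(ℝ, E) 𝓘(ℝ, ℂ) f x

variable (E) in
/-- `(∂̄f)_x(ξ) = (df_x(ξ) + i df_x(iξ)) / 2`, for `ξ ∈ T_x X = E`. -/
def dbar (f : X → ℂ) (x : X) (ξ : E) : ℂ :=
  (realDiff E f x ξ + Complex.I * realDiff E f x (Complex.I • ξ)) / 2

theorem dbar_add {f g : X → ℂ} {x : X} (hf : MDifferentiableAt 𝓘(ℝ, E) 𝓘(ℝ, ℂ) f x)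
    (hg : MDifferentiableAt 𝓘(ℝ, E) 𝓘(ℝ, ℂ) g x) (ξ : E) :
    dbar E (fun q => f q + g q) x ξ = dbar E f x ξ + dbar E g x ξ := by
  have h : realDiff E (fun q => f q + g q) x = realDiff E f x + realDiff E g x :=
    mfderiv_add hf hg
  simp only [dbar, h, add_apply]
  ring

theorem dbar_smul {f : X → ℂ} {x : X} (hf : MDifferentiableAt 𝓘(ℝ, E) 𝓘(ℝ, ℂ) f x)
    (c : ℂ) (ξ : E) : dbar E (fun q => c * f q) x ξ = c * dbar E f x ξ := by
  have h : realDiff E (fun q => c * f q) x = (ContinuousLinearMap.mul ℝ ℂ c) ∘L realDiff E f x :=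
    (((ContinuousLinearMap.mul ℝ ℂ c).hasFDerivAt (x := f x)).hasMFDerivAt.comp x
      hf.hasMFDerivAt).mfderiv
  simp only [dbar, h, ContinuousLinearMap.comp_apply, ContinuousLinearMap.mul_apply']
  ring

theorem dbar_zero (x : X) (ξ : E) : dbar E (fun _ : X => (0 : ℂ)) x ξ = 0 := by
  have := dbar_smul (E := E) (f := fun _ : X => (0 : ℂ)) (x := x) mdifferentiableAt_const 0 ξ
  simpa using this

variable [IsManifold 𝓘(ℂ, E) ω X]

/-- Continuous complex valued functions on the total space of `TX`, with the compact-open topology;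
the continuous 1-forms on `X` are the functions which are linear on the fibres. -/
def FormSpace (E X : Type*) [NormedAddCommGroup E] [NormedSpace ℂ E] [TopologicalSpace X]
    [ChartedSpace E X] [IsManifold 𝓘(ℂ, E) ω X] : Type _ :=
  C(TangentBundle 𝓘(ℂ, E) X, ℂ)

namespace FormSpace

instance : AddCommGroup (FormSpace E X) :=
  inferInstanceAs (AddCommGroup C(TangentBundle 𝓘(ℂ, E) X, ℂ))

instance : Module ℂ (FormSpace E X) :=
  inferInstanceAs (Module ℂ C(TangentBundle 𝓘(ℂ, E) X, ℂ))

instance : TopologicalSpace (FormSpace E X) :=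
  inferInstanceAs (TopologicalSpace C(TangentBundle 𝓘(ℂ, E) X, ℂ))

instance : IsTopologicalAddGroup (FormSpace E X) :=
  inferInstanceAs (IsTopologicalAddGroup C(TangentBundle 𝓘(ℂ, E) X, ℂ))

instance : ContinuousSMul ℂ (FormSpace E X) :=
  inferInstanceAs (ContinuousSMul ℂ C(TangentBundle 𝓘(ℂ, E) X, ℂ))

instance : FunLike (FormSpace E X) (TangentBundle 𝓘(ℂ, E) X) ℂ :=
  inferInstanceAs (FunLike C(TangentBundle 𝓘(ℂ, E) X, ℂ) (TangentBundle 𝓘(ℂ, E) X) ℂ)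

theorem zero_apply (p : TangentBundle 𝓘(ℂ, E) X) : (0 : FormSpace E X) p = 0 := rfl

theorem add_apply (α β : FormSpace E X) (p : TangentBundle 𝓘(ℂ, E) X) :
    (α + β) p = α p + β p := rfl

theorem smul_apply (c : ℂ) (α : FormSpace E X) (p : TangentBundle 𝓘(ℂ, E) X) :
    (c • α) p = c * α p := rfl

end FormSpace

/-- The coordinate vector field around `x` with constant coefficients `w` in the chart at `x`. -/
def coordField (x : X) (w : E) (q : X) : TangentBundle 𝓘(ℂ, E) X :=
  ⟨q, (trivializationAt E (TangentSpace 𝓘(ℂ, E)) x).symm q w⟩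

/-- The smooth `(0,1)`-forms on `X`: conjugate linear on the tangent spaces, with smooth
coefficients in charts. -/
structure IsForm01 (α : TangentBundle 𝓘(ℂ, E) X → ℂ) : Prop where
  map_add : ∀ (x : X) (ξ η : TangentSpace 𝓘(ℂ, E) x), α ⟨x, ξ + η⟩ = α ⟨x, ξ⟩ + α ⟨x, η⟩
  map_smul : ∀ (x : X) (c : ℂ) (ξ : TangentSpace 𝓘(ℂ, E) x), α ⟨x, c • ξ⟩ = conj c * α ⟨x, ξ⟩
  smooth : ∀ (x : X) (w : E),
    ContMDiffAt 𝓘(ℝ, E) 𝓘(ℝ, ℂ) ∞ (fun q => α (coordField x w q)) x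

/-- `∂̄α = 0` for a `(0,1)`-form `α`: in the chart at `x`, with `α = ∑ α_j dz̄_j`, one has
`(∂̄α)_x(v, w) = ∂̄(α(w))(v) - ∂̄(α(v))(w)` for constant vector fields `v`, `w`. -/
def IsDbarClosed (α : TangentBundle 𝓘(ℂ, E) X → ℂ) : Prop :=
  ∀ (x : X) (v w : E),
    dbar E (fun q => α (coordField x w q)) x v
      - dbar E (fun q => α (coordField x v q)) x w = 0

/-- The space `Z^{0,1}(X)` of `∂̄`-closed smooth `(0,1)`-forms, with the topology of uniform
convergence on compact subsets of `TX`. -/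
def Z01 (E X : Type*) [NormedAddCommGroup E] [NormedSpace ℂ E] [TopologicalSpace X]
    [ChartedSpace E X] [IsManifold 𝓘(ℂ, E) ω X] : Submodule ℂ (FormSpace E X) where
  carrier := {α | IsForm01 α ∧ IsDbarClosed α}
  zero_mem' := by
    refine ⟨⟨fun x ξ η => by simp [FormSpace.zero_apply],
      fun x c ξ => by simp [FormSpace.zero_apply], fun x w => ?_⟩, fun x v w => ?_⟩
    · exact contMDiffAt_const
    · simp only [FormSpace.zero_apply, dbar_zero, sub_zero]
  add_mem' := by
    rintro α β ⟨ha, ha'⟩ ⟨hb, hb'⟩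
    refine ⟨⟨fun x ξ η => ?_, fun x c ξ => ?_, fun x w => ?_⟩, fun x v w => ?_⟩
    · simp only [FormSpace.add_apply, ha.map_add, hb.map_add]; ring
    · simp only [FormSpace.add_apply, ha.map_smul, hb.map_smul]; ring
    · exact (ha.smooth x w).add (hb.smooth x w)
    · have d : ∀ u : E, _ := fun u => (ha.smooth x u).mdifferentiableAt (by simp)
      have e : ∀ u : E, _ := fun u => (hb.smooth x u).mdifferentiableAt (by simp)
      simp only [FormSpace.add_apply]
      rw [dbar_add (d w) (e w), dbar_add (d v) (e v)]
      linear_combination ha' x v w + hb' x v w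
  smul_mem' := by
    rintro c α ⟨ha, ha'⟩
    refine ⟨⟨fun x ξ η => ?_, fun x c ξ => ?_, fun x w => ?_⟩, fun x v w => ?_⟩
    · simp only [FormSpace.smul_apply, ha.map_add]; ring
    · simp only [FormSpace.smul_apply, ha.map_smul]; ring
    · exact (ContinuousLinearMap.mul ℝ ℂ c).contMDiff.contMDiffAt.comp x (ha.smooth x w)
    · have d : ∀ u : E, _ := fun u => (ha.smooth x u).mdifferentiableAt (by simp)
      simp only [FormSpace.smul_apply]
      rw [dbar_smul (d w) c, dbar_smul (d v) c]
      linear_combination c * ha' x v w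

/-- The space `B^{0,1}(X)` of `∂̄`-exact forms `∂̄f`, `f` a smooth complex function on `X`. -/
def B01 (E X : Type*) [NormedAddCommGroup E] [NormedSpace ℂ E] [TopologicalSpace X]
    [ChartedSpace E X] [IsManifold 𝓘(ℂ, E) ω X] : Submodule ℂ (Z01 E X) where
  carrier := {α | ∃ f : X → ℂ, ContMDiff 𝓘(ℝ, E) 𝓘(ℝ, ℂ) ∞ f ∧
    ∀ (x : X) (ξ : TangentSpace 𝓘(ℂ, E) x), α.1 ⟨x, ξ⟩ = dbar E f x ξ}
  zero_mem' := by
    refine ⟨fun _ => 0, contMDiff_const, fun x ξ => ?_⟩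
    exact (dbar_zero x _).symm
  add_mem' := by
    rintro α β ⟨f, hf, hf'⟩ ⟨g, hg, hg'⟩
    refine ⟨fun q => f q + g q, hf.add hg, fun x ξ => ?_⟩
    have h := dbar_add (hf.mdifferentiableAt (x := x) (by simp))
      (hg.mdifferentiableAt (x := x) (by simp)) ξ
    exact ((congrArg₂ (· + ·) (hf' x ξ) (hg' x ξ)).trans h.symm)
  smul_mem' := by
    rintro c α ⟨f, hf, hf'⟩
    refine ⟨fun q => c * f q, (ContinuousLinearMap.mul ℝ ℂ c).contMDiff.comp hf, fun x ξ => ?_⟩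
    have h := dbar_smul (hf.mdifferentiableAt (x := x) (by simp)) c ξ
    exact (congrArg (c * ·) (hf' x ξ)).trans h.symm

/-- `H¹(X, 𝒪_X)` as the Dolbeault group `Z^{0,1}(X) / B^{0,1}(X)`, with the quotient topology. (For
compact `X` the subspace `B^{0,1}(X)` is closed and has finite codimension in `Z^{0,1}(X)`, so that
this is the usual topology of a finite dimensional vector space.) -/
abbrev H01 (E X : Type*) [NormedAddCommGroup E] [NormedSpace ℂ E] [TopologicalSpace X]
    [ChartedSpace E X] [IsManifold 𝓘(ℂ, E) ω X] : Type _ :=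
  Z01 E X ⧸ B01 E X

/-- The Dolbeault class of a closed form. -/
def dolbeaultClass (α : Z01 E X) : H01 E X := Submodule.Quotient.mk α

end Dolbeault

/-! ### The complex structure of `Pic(X)` -/

section PicardDifferential

universe w

variable {E X : Type*} [NormedAddCommGroup E] [NormedSpace ℂ E] [TopologicalSpace X]
  [ChartedSpace E X]

/-- The Dolbeault operator of `L` on sections: `∂̄_L(φ e) = ∂̄φ ⊗ e` for a holomorphic frame `e`. -/
def HolLineBundle.dbarSection (L : HolLineBundle.{_, _, _, w} 𝓘(ℂ, E) X) (s : ∀ q, L.fiber q) (x : X)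
    (ξ : TangentSpace 𝓘(ℂ, E) x) : L.fiber x :=
  dbar E (L.coeff x s) x ξ • L.frame x x

variable [IsManifold 𝓘(ℂ, E) ω X]

/-- `L'` is isomorphic to the holomorphic line bundle defined by the integrable semiconnection
`∂̄_L + α` on the smooth line bundle underlying `L`: there is a smooth isomorphism `f : L → L'` of
complex line bundles such that `∂̄_{L'} ∘ f = f ∘ (∂̄_L + α)`. -/
def HolLineBundle.IsTwist (L L' : HolLineBundle.{_, _, _, w} 𝓘(ℂ, E) X) (α : Z01 E X) : Prop :=
  ∃ f : ∀ q, L.fiber q ≃ₗ[ℂ] L'.fiber q,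
    (∀ x, ContMDiffAt 𝓘(ℝ, E) 𝓘(ℝ, ℂ) ∞ (L'.coeff x fun q => f q (L.frame x q)) x) ∧
    ∀ (x : X) (s : ∀ q, L.fiber q), ContMDiffAt 𝓘(ℝ, E) 𝓘(ℝ, ℂ) ∞ (L.coeff x s) x →
      ∀ ξ : TangentSpace 𝓘(ℂ, E) x,
        L'.dbarSection (fun q => f q (s q)) x ξ
          = f x (L.dbarSection s x ξ + α.1 ⟨x, ξ⟩ • s x)

/-- `l' = exp(c) · l`, where `exp : H¹(X, 𝒪_X) → Pic(X)` maps the class of a `∂̄`-closed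
`(0,1)`-form `α` to the trivial bundle with the Dolbeault operator `∂̄ + α`. -/
def IsExpTranslate (l : Pic.{_, _, w} E X) (c : H01 E X) (l' : Pic.{_, _, w} E X) : Prop :=
  ∃ (L L' : HolLineBundle.{_, _, _, w} 𝓘(ℂ, E) X) (α : Z01 E X),
    Quotient.mk (HolLineBundle.setoid 𝓘(ℂ, E) X) L = l ∧
    Quotient.mk (HolLineBundle.setoid 𝓘(ℂ, E) X) L' = l' ∧
    dolbeaultClass α = c ∧ L.IsTwist L' α

/-- The map `φ : Y → Pic(X)` is complex differentiable at `y`, with differential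
`D : T_y Y → T_{φ(y)} Pic(X) = H¹(X, 𝒪_X)`. The complex structure of `Pic(X)` is the one for which
`c ↦ exp(c) · l` is a local biholomorphism `H¹(X, 𝒪_X) → Pic(X)` for every `l`, with differential
the identity at `0`: one reads `φ` in this local coordinate around `l = φ(y)`. -/
def HasPicDifferentialAt {EY Y : Type*} [NormedAddCommGroup EY] [NormedSpace ℂ EY]
    [TopologicalSpace Y] [ChartedSpace EY Y] (φ : Y → Pic.{_, _, w} E X) (y : Y)
    (D : TangentSpace 𝓘(ℂ, EY) y →L[ℂ] H01 E X) : Prop :=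
  ∃ u : Y → H01 E X, u y = 0 ∧ (∀ᶠ y' in 𝓝 y, IsExpTranslate (φ y) (u y') (φ y')) ∧
    HasFDerivAt (𝕜 := ℂ) (E := EY) (u ∘ (extChartAt 𝓘(ℂ, EY) y).symm) D
      (extChartAt 𝓘(ℂ, EY) y y)

end PicardDifferential

/-! ### Hermitian metrics and the Chern curvature -/

section Curvature

universe w

variable {E H : Type*} [NormedAddCommGroup E] [NormedSpace ℂ E] [TopologicalSpace H]
  {I : ModelWithCorners ℂ E H} {M : Type*} [TopologicalSpace M] [ChartedSpace H M]

/-- A smooth Hermitian metric on a holomorphic line bundle over a complex manifold without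
boundary. Smoothness: the function `q ↦ h(e(q), e(q))`, read in the chart at `p`, is smooth at `p`,
for every `p` and the local holomorphic frame `e` around `p`. -/
structure HermitianMetric (L : HolLineBundle.{_, _, _, w} I M) where
  inner : ∀ p, L.fiber p →ₗ⋆[ℂ] L.fiber p →ₗ[ℂ] ℂ
  conj_symm : ∀ p v w, conj (inner p v w) = inner p w v
  pos : ∀ p v, v ≠ 0 → 0 < (inner p v v).re
  smooth : ∀ p, ContDiffAt ℝ ∞
    (fun z => (inner ((extChartAt I p).symm z) (L.frame p ((extChartAt I p).symm z))
      (L.frame p ((extChartAt I p).symm z))).re) (extChartAt I p p)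

namespace HermitianMetric

variable {L : HolLineBundle.{_, _, _, w} I M}

/-- `log h(e, e)` in the chart at `p`, for the local holomorphic frame `e` around `p`. -/
def logNormSq (h : HermitianMetric L) (p : M) (z : E) : ℝ :=
  Real.log (h.inner ((extChartAt I p).symm z) (L.frame p ((extChartAt I p).symm z))
    (L.frame p ((extChartAt I p).symm z))).re

/-- The connection form `θ = ∂ log h(e, e)` of the Chern connection (so `∇e = θ ⊗ e`) in the
chart at `p`, for the local holomorphic frame `e` around `p`:
`θ(w) = (dg(w) - i dg(iw)) / 2` with `g = log h(e, e)`. -/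
def chernForm (h : HermitianMetric L) (p : M) (z : E) : E →L[ℝ] ℂ :=
  (1 / 2 : ℂ) • (Complex.ofRealCLM ∘L fderiv ℝ (h.logNormSq p) z
    - Complex.I • (Complex.ofRealCLM ∘L fderiv ℝ (h.logNormSq p) z ∘L
        (Complex.I • ContinuousLinearMap.id ℝ E)))

/-- The curvature `F = dθ` of the Chern connection at `p`, as a real bilinear form on `T_p M`
(identified with `E` by the chart at `p`). -/
def curvature (h : HermitianMetric L) (p : M) (v w : TangentSpace I p) : ℂ :=
  fderiv ℝ (h.chernForm p) (extChartAt I p p) v w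
    - fderiv ℝ (h.chernForm p) (extChartAt I p p) w v

end HermitianMetric

/-- The `(0,1)`-part of the 1-form `ξ ↦ F((v, 0), (0, ξ))` on `X`, where `F` is the Chern curvature
of a Hermitian metric on a line bundle over `Y × X` and `v ∈ T_y Y`. -/
def HermitianMetric.contraction01 {EY EX Y X : Type*} [NormedAddCommGroup EY] [NormedSpace ℂ EY]
    [NormedAddCommGroup EX] [NormedSpace ℂ EX]
    [TopologicalSpace Y] [ChartedSpace EY Y] [TopologicalSpace X] [ChartedSpace EX X]
    {L : HolLineBundle.{_, _, _, w} (𝓘(ℂ, EY).prod 𝓘(ℂ, EX)) (Y × X)} (h : HermitianMetric L)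
    (y : Y) (v : TangentSpace 𝓘(ℂ, EY) y) (x : X) (ξ : TangentSpace 𝓘(ℂ, EX) x) : ℂ :=
  (h.curvature (y, x) ((v, 0) : EY × EX) ((0, ξ) : EY × EX)
    + Complex.I * h.curvature (y, x) ((v, 0) : EY × EX) ((0, Complex.I • ξ) : EY × EX)) / 2

end Curvature

end

/-! Write `e_c` for the holomorphic frame of `L` around `(y, c)`, and take a finite smooth partition
of unity `ρ_c` on `X` subordinate to the domains of these frames over `{y} × X`. For `y'` near `y`
the maps carrying `e_c(y, x)` to `e_c(y', x)` are holomorphic in `x`; weighted by `ρ_c` they add up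
to a smooth homomorphism `L_y → L_{y'}`. In a frame `e_p` it is multiplication by `A = ∑ ρ_c r_c`
(`mult`), where `r_c` (`ratio`) is holomorphic in `(y', x)` and equals 1 at `y' = y`. So `A = 1` at
`y`, and by compactness of `X` the homomorphism is invertible for all `y'` near `y`
(`eventually_good`). Pulling back the holomorphic structure of `L_{y'}` gives `∂̄ + α` on `L_y`,
with `α = ∂̄A / A = (∑ ∂̄ρ_c r_c) / A` (`isTwist`); locally `α = ∂̄ log A`, hence `α` is closed.

Because `∑ ∂̄ρ_c = 0`, also `α = ∑ ∂̄ρ_c (r_c - 1) / A`, so the derivative of `α` at `y` along `v`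
is `∑ ∂̄ρ_c d_Y r_c(v)`. On the metric side, `θ_c = ∂ log h(e_c, e_c)` has type (1,0) and `F =
dθ_c`, so the (0,1)-part of `ι_v F` on `X` is `-∂̄(θ_c(v))`, while a change of frame gives `θ_c(v) =
θ_p(v) + d_Y r_c(v)`. Applying `∂̄` to the global function `∑ ρ_c θ_c(v)` (`correction`) therefore
yields `∑ ∂̄ρ_c d_Y r_c(v)` minus the contraction (`contraction01_add_dbar_correction`): the
derivative of `α` and the contraction differ by an exact form.

The analytic point is that the first order expansion of `α` holds locally uniformly on `TX`. It
comes from strict differentiability of holomorphic functions on `Y × X` (`isLittleO_sub_fderivY`)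
and passes to the Dolbeault quotient by `hasFDerivAt_mkQ`. -/

noncomputable section

/-! ### Real structure of a complex manifold and calculus of `∂̄` on functions -/

section RealStructure

variable {E X : Type*} [NormedAddCommGroup E] [NormedSpace ℂ E] [TopologicalSpace X]
  [ChartedSpace E X]

/-- The real analytic manifold underlying a complex manifold. -/
theorem isManifold_real [IsManifold 𝓘(ℂ, E) ω X] (n : ℕ∞ω) : IsManifold 𝓘(ℝ, E) n X := by
  have : IsManifold 𝓘(ℝ, E) ω X := by
    refine isManifold_of_contDiffOn 𝓘(ℝ, E) ω X fun e e' he he' => ?_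
    have h := (contDiffGroupoid ω 𝓘(ℂ, E)).compatible he he'
    rw [contDiffGroupoid, mem_groupoid_of_pregroupoid] at h
    exact ContDiffOn.restrict_scalars ℝ h.1
  exact IsManifold.of_le (n := ω) le_top

theorem contMDiffAt_iff_contDiffAt_chart {𝕜 E F X : Type*} [NontriviallyNormedField 𝕜]
    [NormedAddCommGroup E] [NormedSpace 𝕜 E] [NormedAddCommGroup F] [NormedSpace 𝕜 F]
    [TopologicalSpace X] [ChartedSpace E X] {n : ℕ∞ω} [IsManifold 𝓘(𝕜, E) n X] {f : X → F}
    {p q : X} (hq : q ∈ (chartAt E p).source) :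
    ContMDiffAt 𝓘(𝕜, E) 𝓘(𝕜, F) n f q ↔
      ContDiffAt 𝕜 n (f ∘ (chartAt E p).symm) (chartAt E p q) := by
  rw [contMDiffAt_iff_source_of_mem_source (x := p) (by simpa using hq),
    contMDiffWithinAt_iff_contDiffWithinAt]
  simp [contDiffWithinAt_univ]

theorem mdifferentiableAt_iff_chart {𝕜 E F X : Type*} [NontriviallyNormedField 𝕜]
    [NormedAddCommGroup E] [NormedSpace 𝕜 E] [NormedAddCommGroup F] [NormedSpace 𝕜 F]
    [TopologicalSpace X] [ChartedSpace E X] [IsManifold 𝓘(𝕜, E) 1 X] {f : X → F}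
    {p q : X} (hq : q ∈ (chartAt E p).source) :
    MDifferentiableAt 𝓘(𝕜, E) 𝓘(𝕜, F) f q ↔
      DifferentiableAt 𝕜 (f ∘ (chartAt E p).symm) (chartAt E p q) := by
  rw [mdifferentiableAt_iff_source_of_mem_source (x := p) (by simpa using hq),
    mdifferentiableWithinAt_iff_differentiableWithinAt]
  simp [differentiableWithinAt_univ]

theorem ContMDiffAt.restrictScalars_real [IsManifold 𝓘(ℂ, E) ω X] {f : X → ℂ} {x : X} {n : ℕ∞ω}
    (h : ContMDiffAt 𝓘(ℂ, E) 𝓘(ℂ, ℂ) n f x) : ContMDiffAt 𝓘(ℝ, E) 𝓘(ℝ, ℂ) n f x := by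
  have := isManifold_real (E := E) (X := X) n
  have : IsManifold 𝓘(ℂ, E) n X := IsManifold.of_le (n := ω) le_top
  rw [contMDiffAt_iff_contDiffAt_chart (mem_chart_source E x)] at h ⊢
  exact h.restrict_scalars ℝ

/-- The `∂̄`-operator on functions on a complex vector space. -/
def flatDbar (g : E → ℂ) (z ξ : E) : ℂ :=
  (fderiv ℝ g z ξ + Complex.I * fderiv ℝ g z (Complex.I • ξ)) / 2

theorem realDiff_eq_fderiv {f : X → ℂ} {x : X}
    (hf : MDifferentiableAt 𝓘(ℝ, E) 𝓘(ℝ, ℂ) f x) :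
    realDiff E f x = fderiv ℝ (f ∘ (chartAt E x).symm) (chartAt E x x) := by
  have h := hf.mfderiv
  simp only [writtenInExtChartAt, extChartAt_model_space_eq_id, PartialEquiv.refl_coe,
    Function.id_comp, modelWithCornersSelf_coe, Set.range_id, fderivWithin_univ] at h
  rw [realDiff, h]
  rfl

theorem dbar_eq_flatDbar {f : X → ℂ} {x : X}
    (hf : MDifferentiableAt 𝓘(ℝ, E) 𝓘(ℝ, ℂ) f x) (ξ : E) :
    dbar E f x ξ = flatDbar (f ∘ (chartAt E x).symm) (chartAt E x x) ξ := by
  simp only [dbar, flatDbar, realDiff_eq_fderiv hf]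

theorem dbar_congr {f g : X → ℂ} {x : X} (h : f =ᶠ[𝓝 x] g) (ξ : E) :
    dbar E f x ξ = dbar E g x ξ := by
  have : realDiff E f x = realDiff E g x := h.mfderiv_eq
  simp only [dbar, this]

theorem dbar_map_add (f : X → ℂ) (x : X) (ξ η : E) :
    dbar E f x (ξ + η) = dbar E f x ξ + dbar E f x η := by
  simp only [dbar, smul_add, map_add]; ring

theorem dbar_map_smul (f : X → ℂ) (x : X) (c : ℂ) (ξ : E) :
    dbar E f x (c • ξ) = conj c * dbar E f x ξ := by
  have key : ∀ (l : E →L[ℝ] ℂ) (c : ℂ) (ξ : E),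
      l (c • ξ) = c.re * l ξ + c.im * l (Complex.I • ξ) := by
    intro l c ξ
    have : c • ξ = c.re • ξ + c.im • (Complex.I • ξ) := by
      conv_lhs => rw [← Complex.re_add_im c]
      rw [add_smul, mul_smul, Complex.coe_smul, Complex.coe_smul]
    rw [this, map_add, map_smul, map_smul]
    simp
  have h1 := key (realDiff E f x) c ξ
  have h2 := key (realDiff E f x) c (Complex.I • ξ)
  simp only [dbar]
  rw [smul_smul Complex.I Complex.I ξ, Complex.I_mul_I, neg_one_smul, map_neg] at h2
  rw [smul_comm Complex.I c ξ, h1, h2]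
  have hc : conj c = c.re - c.im * Complex.I := by
    apply Complex.ext <;> simp
  rw [hc]
  linear_combination ((1/2) * c.im * realDiff E f x (Complex.I • ξ)) * Complex.I_sq

theorem dbar_mul {f g : X → ℂ} {x : X} (hf : MDifferentiableAt 𝓘(ℝ, E) 𝓘(ℝ, ℂ) f x)
    (hg : MDifferentiableAt 𝓘(ℝ, E) 𝓘(ℝ, ℂ) g x) (ξ : E) :
    dbar E (fun q => f q * g q) x ξ = f x * dbar E g x ξ + g x * dbar E f x ξ := by
  have h : realDiff E (fun q => f q * g q) x = f x • realDiff E g x + g x • realDiff E f x :=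
    (hf.hasMFDerivAt.mul hg.hasMFDerivAt).mfderiv
  simp only [dbar, h, add_apply, smul_apply, smul_eq_mul]
  ring

theorem dbar_comp {f : X → ℂ} {x : X} {F : ℂ → ℂ} {F' : ℂ}
    (hf : MDifferentiableAt 𝓘(ℝ, E) 𝓘(ℝ, ℂ) f x) (hF : HasDerivAt F F' (f x)) (ξ : E) :
    dbar E (fun q => F (f q)) x ξ = F' * dbar E f x ξ := by
  have h : realDiff E (fun q => F (f q)) x = (ContinuousLinearMap.mul ℝ ℂ F') ∘L realDiff E f x := by
    have h0 : HasFDerivAt (𝕜 := ℝ) F (ContinuousLinearMap.mul ℝ ℂ F') (f x) := by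
      have e : (ContinuousLinearMap.mul ℝ ℂ F') =
          (ContinuousLinearMap.toSpanSingleton ℂ F').restrictScalars ℝ := by
        ext <;> simp [mul_comm]
      rw [e]
      exact hF.hasFDerivAt.restrictScalars ℝ
    exact (h0.hasMFDerivAt.comp x hf.hasMFDerivAt).mfderiv
  simp only [dbar, h, ContinuousLinearMap.comp_apply, ContinuousLinearMap.mul_apply']
  ring

theorem dbar_const (c : ℂ) (x : X) (ξ : E) : dbar E (fun _ : X => c) x ξ = 0 := by
  have : realDiff E (fun _ : X => c) x = 0 := mfderiv_const
  simp [dbar, this]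

theorem mdifferentiableAt_real_sum {ι : Type*} {s : Finset ι} {f : ι → X → ℂ} {x : X}
    (hf : ∀ i ∈ s, MDifferentiableAt 𝓘(ℝ, E) 𝓘(ℝ, ℂ) (f i) x) :
    MDifferentiableAt 𝓘(ℝ, E) 𝓘(ℝ, ℂ) (fun q => ∑ i ∈ s, f i q) x := by
  classical
  induction s using Finset.induction_on with
  | empty => simpa using mdifferentiableAt_const
  | insert a s ha ih =>
    simp only [Finset.sum_insert ha]
    exact (hf a (by simp)).add (ih fun i hi => hf i (by simp [hi]))

theorem dbar_sum {ι : Type*} {s : Finset ι} {f : ι → X → ℂ} {x : X}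
    (hf : ∀ i ∈ s, MDifferentiableAt 𝓘(ℝ, E) 𝓘(ℝ, ℂ) (f i) x) (ξ : E) :
    dbar E (fun q => ∑ i ∈ s, f i q) x ξ = ∑ i ∈ s, dbar E (f i) x ξ := by
  classical
  induction s using Finset.induction_on with
  | empty => simpa using dbar_zero x ξ
  | insert a s ha ih =>
    simp only [Finset.sum_insert ha]
    have h' : ∀ i ∈ s, MDifferentiableAt 𝓘(ℝ, E) 𝓘(ℝ, ℂ) (f i) x := fun i hi => hf i (by simp [hi])
    rw [dbar_add (hf a (by simp)) (mdifferentiableAt_real_sum h'), ih h']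

theorem dbar_of_holomorphic [IsManifold 𝓘(ℂ, E) ω X] {f : X → ℂ} {x : X}
    (h : MDifferentiableAt 𝓘(ℂ, E) 𝓘(ℂ, ℂ) f x) (ξ : E) : dbar E f x ξ = 0 := by
  have := isManifold_real (E := E) (X := X) 1
  have : IsManifold 𝓘(ℂ, E) 1 X := IsManifold.of_le (n := ω) le_top
  rw [mdifferentiableAt_iff_chart (mem_chart_source E x)] at h
  have h' := h.restrictScalars ℝ
  rw [dbar_eq_flatDbar ((mdifferentiableAt_iff_chart (mem_chart_source E x)).2 h'), flatDbar,
    h.fderiv_restrictScalars ℝ]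
  simp only [ContinuousLinearMap.coe_restrictScalars', map_smul, smul_eq_mul]
  linear_combination (1 / 2 * fderiv ℂ (f ∘ (chartAt E x).symm) (chartAt E x x) ξ) * Complex.I_sq

end RealStructure

/-! ### Locally `∂̄`-exact forms are smooth, closed and continuous on `TX` -/

section LocallyExact

variable {E X : Type*} [NormedAddCommGroup E] [NormedSpace ℂ E] [TopologicalSpace X]
  [ChartedSpace E X] [IsManifold 𝓘(ℂ, E) ω X]

theorem coordField_snd {x q : X} (hq : q ∈ (chartAt E x).source) (w : E) :
    (coordField x w q).2 = tangentCoordChange 𝓘(ℂ, E) x q q w := by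
  have h := TangentBundle.symmL_trivializationAt_eq_core (I := 𝓘(ℂ, E)) hq
  have h2 := congrArg (fun l => l w) h
  have hq' : q ∈ (trivializationAt E (TangentSpace 𝓘(ℂ, E)) x).baseSet := by simpa using hq
  exact (Trivialization.symmL_apply (R := ℂ) _ hq' w).symm.trans h2

/-- The differential at `q` is read in the chart at `q`, the coordinate field in the chart at `x`.
The chain rule through the transition map produces the two tangent coordinate changes between these
charts, which cancel. -/
theorem realDiff_coordField {f : X → ℂ} {x q : X} (hq : q ∈ (chartAt E x).source)
    (hf : MDifferentiableAt 𝓘(ℝ, E) 𝓘(ℝ, ℂ) f q) (w : E) :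
    realDiff E f q (coordField x w q).2
      = fderiv ℝ (f ∘ (chartAt E x).symm) (chartAt E x q) w := by
  have := isManifold_real (E := E) (X := X) 1
  have hq' : q ∈ (extChartAt 𝓘(ℂ, E) x).source := by simpa using hq
  have hqq : q ∈ (extChartAt 𝓘(ℂ, E) q).source := mem_extChartAt_source q
  have hF := (mdifferentiableAt_iff_chart hq).1 hf
  have hτ := hasFDerivWithinAt_tangentCoordChange (I := 𝓘(ℂ, E)) (x := q) (y := x) (z := q) ⟨hqq, hq'⟩
  rw [modelWithCornersSelf_coe, Set.range_id, hasFDerivWithinAt_univ] at hτ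
  have hτ' : HasFDerivAt (𝕜 := ℝ) (chartAt E x ∘ (chartAt E q).symm)
      ((tangentCoordChange 𝓘(ℂ, E) q x q).restrictScalars ℝ) (chartAt E q q) := hτ.restrictScalars ℝ
  have hpt : (chartAt E x ∘ (chartAt E q).symm) (chartAt E q q) = chartAt E x q := by simp
  have hc := (hpt ▸ hF.hasFDerivAt).comp (chartAt E q q) hτ'
  have heq : (f ∘ (chartAt E q).symm) =ᶠ[𝓝 (chartAt E q q)]
      ((f ∘ (chartAt E x).symm) ∘ (chartAt E x ∘ (chartAt E q).symm)) := by
    have h1 : ∀ᶠ z in 𝓝 (chartAt E q q), (chartAt E q).symm z ∈ (chartAt E x).source := by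
      refine ((chartAt E q).continuousAt_symm (mem_chart_target E q)).eventually_mem ?_
      simpa using (chartAt E x).open_source.mem_nhds hq
    filter_upwards [h1] with z hz
    simp [(chartAt E x).left_inv hz]
  rw [realDiff_eq_fderiv hf, heq.fderiv_eq, hc.fderiv, coordField_snd hq]
  simp only [ContinuousLinearMap.comp_apply, ContinuousLinearMap.coe_restrictScalars']
  congr 1
  · rw [hpt]
  · have h2 := tangentCoordChange_comp (I := 𝓘(ℂ, E)) (w := x) (x := q) (y := x) (z := q) (v := w)
      ⟨⟨hq', hqq⟩, hq'⟩
    exact h2.trans (tangentCoordChange_self hq')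

/-- The coordinate change of `TX` is complex linear, so multiplication by `I` commutes with passing
to the coordinate field. -/
theorem dbar_coordField {f : X → ℂ} {x q : X} (hq : q ∈ (chartAt E x).source)
    (hf : MDifferentiableAt 𝓘(ℝ, E) 𝓘(ℝ, ℂ) f q) (w : E) :
    dbar E f q (coordField x w q).2 = flatDbar (f ∘ (chartAt E x).symm) (chartAt E x q) w := by
  have h : Complex.I • (coordField x w q).2 = (coordField x (Complex.I • w) q).2 := by
    rw [coordField_snd hq, coordField_snd hq]
    exact (map_smul (tangentCoordChange 𝓘(ℂ, E) x q q) _ _).symm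
  unfold dbar flatDbar
  rw [realDiff_coordField hq hf]
  have h3 := realDiff_coordField hq hf (Complex.I • w)
  rw [← h] at h3
  erw [h3]

/-- A form which is locally of the shape `∂̄g` with `g` smooth. -/
def LocallyExact (α : TangentBundle 𝓘(ℂ, E) X → ℂ) : Prop :=
  ∀ x : X, ∃ g : X → ℂ, ContMDiffAt 𝓘(ℝ, E) 𝓘(ℝ, ℂ) ∞ g x ∧
    ∀ᶠ q in 𝓝 x, ∀ ξ : TangentSpace 𝓘(ℂ, E) q, α ⟨q, ξ⟩ = dbar E g q ξ

theorem ContMDiffAt.eventually_mdifferentiableAt {g : X → ℂ} {x : X}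
    (hg : ContMDiffAt 𝓘(ℝ, E) 𝓘(ℝ, ℂ) ∞ g x) :
    ∀ᶠ q in 𝓝 x, MDifferentiableAt 𝓘(ℝ, E) 𝓘(ℝ, ℂ) g q := by
  have := isManifold_real (E := E) (X := X) 1
  have h1 : ContMDiffAt 𝓘(ℝ, E) 𝓘(ℝ, ℂ) 1 g x := hg.of_le (by simp)
  filter_upwards [(contMDiffAt_iff_contMDiffAt_nhds (by simp)).1 h1] with q hq
  exact hq.mdifferentiableAt (by simp)

theorem eventually_dbar_coordField {g : X → ℂ} {x : X}
    (hg : ContMDiffAt 𝓘(ℝ, E) 𝓘(ℝ, ℂ) ∞ g x) :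
    ∀ᶠ q in 𝓝 x, ∀ w : E, dbar E g q (coordField x w q).2
      = flatDbar (g ∘ (chartAt E x).symm) (chartAt E x q) w := by
  filter_upwards [hg.eventually_mdifferentiableAt, chart_source_mem_nhds E x] with q h1 h2 w
  exact dbar_coordField h2 h1 w

theorem ContDiffAt.flatDbar {f : E → ℂ} {z : E} (hf : ContDiffAt ℝ ∞ f z) (w : E) :
    ContDiffAt ℝ ∞ (fun u => flatDbar f u w) z := by
  have h : ContDiffAt ℝ ∞ (fderiv ℝ f) z := hf.fderiv_right (by simp)
  unfold _root_.flatDbar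
  have h1 := h.clm_apply (contDiffAt_const (c := w))
  have h2 := h.clm_apply (contDiffAt_const (c := Complex.I • w))
  exact (h1.add (contDiffAt_const.mul h2)).div_const 2

/-- This is `∂̄² = 0`: both sides expand into the same four second derivatives once the second
derivative is known to be symmetric. -/
theorem flatDbar_flatDbar_comm {f : E → ℂ} {z : E} (hf : ContDiffAt ℝ ∞ f z) (v w : E) :
    flatDbar (fun u => flatDbar f u w) z v = flatDbar (fun u => flatDbar f u v) z w := by
  have h : ContDiffAt ℝ 1 (fderiv ℝ f) z := hf.fderiv_right (by norm_cast)
  have hd := (h.differentiableAt (by simp)).hasFDerivAt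
  have hsym : ∀ a b, fderiv ℝ (fderiv ℝ f) z a b = fderiv ℝ (fderiv ℝ f) z b a :=
    (hf.isSymmSndFDerivAt (by simp; norm_cast)).eq
  have key : ∀ w v, flatDbar (fun u => flatDbar f u w) z v =
      (fderiv ℝ (fderiv ℝ f) z v w + Complex.I * fderiv ℝ (fderiv ℝ f) z v (Complex.I • w)
      + Complex.I * (fderiv ℝ (fderiv ℝ f) z (Complex.I • v) w
        + Complex.I * fderiv ℝ (fderiv ℝ f) z (Complex.I • v) (Complex.I • w))) / 4 := by
    intro w v
    have e : ∀ u, HasFDerivAt (fun y => fderiv ℝ f y u)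
        ((fderiv ℝ (fderiv ℝ f) z).flip u) z := fun u => by
      simpa using hd.clm_apply (hasFDerivAt_const u z)
    have e2 := ((e w).add ((e (Complex.I • w)).const_mul Complex.I)).mul_const (2⁻¹ : ℂ)
    have e3 : fderiv ℝ (fun u => flatDbar f u w) z = _ := e2.fderiv
    rw [flatDbar, e3]
    simp
    ring
  rw [key, key, hsym v w, hsym v (Complex.I • w), hsym (Complex.I • v) w,
    hsym (Complex.I • v) (Complex.I • w)]
  ring

namespace LocallyExact

variable {α : TangentBundle 𝓘(ℂ, E) X → ℂ}

theorem exists_chart (hα : LocallyExact α) (x : X) :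
    ∃ g : X → ℂ, ContMDiffAt 𝓘(ℝ, E) 𝓘(ℝ, ℂ) ∞ g x ∧
    ∀ᶠ q in 𝓝 x, ∀ w : E, α (coordField x w q)
      = flatDbar (g ∘ (chartAt E x).symm) (chartAt E x q) w := by
  obtain ⟨g, hg, h⟩ := hα x
  refine ⟨g, hg, ?_⟩
  filter_upwards [h, eventually_dbar_coordField hg] with q h1 h2 w
  rw [← h2]
  exact h1 _

theorem contMDiffAt_coord {f : E → ℂ} {x : X} (hf : ContDiffAt ℝ ∞ f (chartAt E x x)) :
    ContMDiffAt 𝓘(ℝ, E) 𝓘(ℝ, ℂ) ∞ (fun q => f (chartAt E x q)) x := by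
  have := isManifold_real (E := E) (X := X) ∞
  rw [contMDiffAt_iff_contDiffAt_chart (mem_chart_source E x)]
  refine hf.congr_of_eventuallyEq ?_
  filter_upwards [chart_target_mem_nhds E x] with z hz
  simp [(chartAt E x).right_inv hz]

theorem isForm01 (hα : LocallyExact α) : IsForm01 α where
  map_add x ξ η := by
    obtain ⟨g, hg, h⟩ := hα x
    rw [h.self_of_nhds, h.self_of_nhds, h.self_of_nhds]
    exact dbar_map_add (E := E) g x ξ η
  map_smul x c ξ := by
    obtain ⟨g, hg, h⟩ := hα x
    rw [h.self_of_nhds, h.self_of_nhds]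
    exact dbar_map_smul (E := E) g x c ξ
  smooth x w := by
    have := isManifold_real (E := E) (X := X) ∞
    obtain ⟨g, hg, h⟩ := hα.exists_chart x
    rw [contMDiffAt_iff_contDiffAt_chart (mem_chart_source E x)] at hg
    refine ContMDiffAt.congr_of_eventuallyEq (contMDiffAt_coord (hg.flatDbar w)) ?_
    filter_upwards [h] with q hq
    exact hq w

theorem isDbarClosed (hα : LocallyExact α) : IsDbarClosed α := by
  intro x v w
  have := isManifold_real (E := E) (X := X) ∞
  have := isManifold_real (E := E) (X := X) 1
  obtain ⟨g, hg, h⟩ := hα.exists_chart x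
  rw [contMDiffAt_iff_contDiffAt_chart (mem_chart_source E x)] at hg
  have key : ∀ v w : E, dbar E (fun q => α (coordField x w q)) x v
      = flatDbar (fun u => flatDbar (g ∘ (chartAt E x).symm) u w) (chartAt E x x) v := by
    intro v w
    have h1 : (fun q => α (coordField x w q)) =ᶠ[𝓝 x]
        fun q => flatDbar (g ∘ (chartAt E x).symm) (chartAt E x q) w := h.mono fun q hq => hq w
    have h2 := (contMDiffAt_coord (hg.flatDbar w)).mdifferentiableAt (by simp)
    rw [dbar_congr h1, dbar_eq_flatDbar h2]
    have h3 : ((fun q => flatDbar (g ∘ (chartAt E x).symm) (chartAt E x q) w) ∘ (chartAt E x).symm)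
        =ᶠ[𝓝 (chartAt E x x)] fun u => flatDbar (g ∘ (chartAt E x).symm) u w := by
      filter_upwards [chart_target_mem_nhds E x] with z hz
      simp [(chartAt E x).right_inv hz]
    unfold _root_.flatDbar at h3 ⊢
    rw [h3.fderiv_eq]
  rw [key, key, flatDbar_flatDbar_comm hg, sub_self]

/-- In the trivialization of `TX` around `x` the form is the derivative of the primitive in the
chart, which varies continuously, evaluated at the continuous fibre coordinate. -/
theorem continuous (hα : LocallyExact α) : Continuous α := by
  rw [continuous_iff_continuousAt]
  rintro ⟨x, ξ⟩
  have := isManifold_real (E := E) (X := X) ∞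
  obtain ⟨g, hg, h⟩ := hα.exists_chart x
  rw [contMDiffAt_iff_contDiffAt_chart (mem_chart_source E x)] at hg
  have hproj : Tendsto (TotalSpace.proj : TangentBundle 𝓘(ℂ, E) X → X) (𝓝 ⟨x, ξ⟩) (𝓝 x) :=
    (FiberBundle.continuous_proj E (TangentSpace 𝓘(ℂ, E))).continuousAt
  let T := trivializationAt E (TangentSpace 𝓘(ℂ, E) : X → Type _) x
  have hx : x ∈ T.baseSet := FiberBundle.mem_baseSet_trivializationAt' x
  have hT : ContinuousAt (fun p => (T p).2) (⟨x, ξ⟩ : TangentBundle 𝓘(ℂ, E) X) :=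
    continuousAt_snd.comp (T.continuousOn.continuousAt (T.open_source.mem_nhds (by simpa [T.mem_source] using hx)))
  have hg1 : ContinuousAt (fderiv ℝ (g ∘ (chartAt E x).symm)) (chartAt E x x) :=
    (hg.fderiv_right (m := 0) (by simp)).continuousAt
  have hg2 : ContinuousAt (fun p : TangentBundle 𝓘(ℂ, E) X =>
      fderiv ℝ (g ∘ (chartAt E x).symm) (chartAt E x p.1)) ⟨x, ξ⟩ := by
    refine ContinuousAt.comp (f := fun p : TangentBundle 𝓘(ℂ, E) X => chartAt E x p.1) hg1 ?_
    exact ContinuousAt.comp (f := fun p : TangentBundle 𝓘(ℂ, E) X => p.1)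
      ((chartAt E x).continuousAt (mem_chart_source E x)) hproj
  have hF : ContinuousAt (fun p : TangentBundle 𝓘(ℂ, E) X =>
      flatDbar (g ∘ (chartAt E x).symm) (chartAt E x p.1) (T p).2) ⟨x, ξ⟩ := by
    unfold flatDbar
    exact ((hg2.clm_apply hT).add
      (continuousAt_const.mul (hg2.clm_apply (hT.const_smul Complex.I)))).div_const 2
  refine hF.congr ?_
  filter_upwards [hproj.eventually h, hproj.eventually (T.open_baseSet.mem_nhds hx)] with p hp hp'
  rw [← hp]
  congr 1
  have : T.symm p.1 (T p).2 = p.2 := by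
    have := T.symm_apply_apply_mk hp' p.2
    exact this
  exact congrArg (TotalSpace.mk p.1) this

/-- A locally exact form, as an element of `Z^{0,1}(X)`. -/
def toZ01 (hα : LocallyExact α) : Z01 E X :=
  ⟨(⟨α, hα.continuous⟩ : C(TangentBundle 𝓘(ℂ, E) X, ℂ)), hα.isForm01, hα.isDbarClosed⟩

end LocallyExact

end LocallyExact

/-! ### Transition functions between local holomorphic frames -/

section Transition

variable {E H : Type*} [NormedAddCommGroup E] [NormedSpace ℂ E] [TopologicalSpace H]
  {I : ModelWithCorners ℂ E H} {M : Type*} [TopologicalSpace M] [ChartedSpace H M]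

namespace HolLineBundle

variable (L : HolLineBundle I M)

/-- The domain of the preferred local holomorphic frame around `p`. -/
def base (p : M) : Set M := (trivializationAt ℂ L.fiber p).baseSet

theorem isOpen_base (p : M) : IsOpen (L.base p) := (trivializationAt ℂ L.fiber p).open_baseSet

theorem mem_base_self (p : M) : p ∈ L.base p := FiberBundle.mem_baseSet_trivializationAt' p

theorem base_mem_nhds (p : M) : L.base p ∈ 𝓝 p := (L.isOpen_base p).mem_nhds (L.mem_base_self p)

/-- The transition function between the local holomorphic frames around `p` and `p'`. -/
def transition (p p' q : M) : ℂ := L.coeff p' (L.frame p) q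

variable {L}

theorem coeff_smul_frame {p q : M} (hq : q ∈ L.base p) (s : ∀ q, L.fiber q) :
    L.coeff p s q • L.frame p q = s q := by
  have h := (trivializationAt ℂ L.fiber p).symm_apply_apply_mk hq (s q)
  have h2 := map_smul ((trivializationAt ℂ L.fiber p).symmₗ ℂ q) (L.coeff p s q) 1
  rw [smul_eq_mul, mul_one, Trivialization.coe_symmₗ _ hq] at h2
  exact h2.symm.trans h

theorem frame_ne_zero {p q : M} (hq : q ∈ L.base p) : L.frame p q ≠ 0 := by
  intro h
  have h1 := (trivializationAt ℂ L.fiber p).apply_mk_symm hq (1 : ℂ)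
  have h2 := ((trivializationAt ℂ L.fiber p).linear ℂ hq).map_zero
  have h3 : (trivializationAt ℂ L.fiber p ⟨q, L.frame p q⟩).2 = 1 := congrArg Prod.snd h1
  rw [h] at h3
  exact zero_ne_one (h2.symm.trans h3)

theorem frame_eq {p p' q : M} (hq' : q ∈ L.base p') :
    L.frame p q = L.transition p p' q • L.frame p' q :=
  (coeff_smul_frame hq' _).symm

theorem coeff_eq_of_eq_smul {p q : M} (hq : q ∈ L.base p) {s : ∀ q, L.fiber q} {c : ℂ}
    (h : s q = c • L.frame p q) : L.coeff p s q = c :=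
  smul_left_injective ℂ (frame_ne_zero hq) ((coeff_smul_frame hq s).trans h)

theorem transition_self {p q : M} (hq : q ∈ L.base p) : L.transition p p q = 1 :=
  coeff_eq_of_eq_smul hq (one_smul _ _).symm

theorem transition_mul {p p' p'' q : M} (hq' : q ∈ L.base p') (hq'' : q ∈ L.base p'') :
    L.transition p p' q * L.transition p' p'' q = L.transition p p'' q := by
  refine (coeff_eq_of_eq_smul hq'' ?_).symm
  rw [mul_smul, ← frame_eq hq'', ← frame_eq hq']

theorem transition_mul_symm {p p' q : M} (hq : q ∈ L.base p) (hq' : q ∈ L.base p') :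
    L.transition p p' q * L.transition p' p q = 1 := by
  rw [transition_mul hq' hq, transition_self hq]

theorem transition_ne_zero {p p' q : M} (hq : q ∈ L.base p) (hq' : q ∈ L.base p') :
    L.transition p p' q ≠ 0 :=
  left_ne_zero_of_mul_eq_one (transition_mul_symm hq hq')

/-- Near `q` the transition function is the coordinate change of the bundle applied to `1`, and
coordinate changes are holomorphic. -/
theorem contMDiffAt_transition {p p' q : M} (hq : q ∈ L.base p) (hq' : q ∈ L.base p') :
    ContMDiffAt I 𝓘(ℂ, ℂ) ω (L.transition p p') q := by
  have h := contMDiffAt_coordChangeL (n := ω) (IB := I) (e := trivializationAt ℂ L.fiber p)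
    (e' := trivializationAt ℂ L.fiber p') hq hq'
  have h1 : ContMDiffAt I 𝓘(ℂ, ℂ) ω (fun b =>
      ((trivializationAt ℂ L.fiber p).coordChangeL ℂ (trivializationAt ℂ L.fiber p') b : ℂ →L[ℂ] ℂ) 1) q :=
    h.clm_apply contMDiffAt_const
  refine h1.congr_of_eventuallyEq ?_
  filter_upwards [(L.isOpen_base p).mem_nhds hq, (L.isOpen_base p').mem_nhds hq'] with b hb hb'
  exact (Trivialization.coordChangeL_apply _ _ ⟨hb, hb'⟩ 1).symm

end HolLineBundle

end Transition

/-! ### Holomorphic functions on `Y × X`: first order expansion in `Y`, uniform in `X` -/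

section Product

variable {EY EX Y X : Type*} [NormedAddCommGroup EY] [NormedSpace ℂ EY]
  [NormedAddCommGroup EX] [NormedSpace ℂ EX]
  [TopologicalSpace Y] [ChartedSpace EY Y]
  [TopologicalSpace X] [ChartedSpace EX X]

/-- A function on `Y × X` in the product of the charts at `y` and `x`. -/
def inCharts (EY EX : Type*) [NormedAddCommGroup EY] [NormedAddCommGroup EX]
    [ChartedSpace EY Y] [ChartedSpace EX X] {β : Type*} (F : Y × X → β) (y : Y) (x : X) (z : EY × EX) : β :=
  F ((chartAt EY y).symm z.1, (chartAt EX x).symm z.2)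

theorem ContMDiffAt.contDiffAt_inCharts [IsManifold 𝓘(ℂ, EY) ω Y] [IsManifold 𝓘(ℂ, EX) ω X]
    {F : Y × X → ℂ} {y y' : Y} {x x' : X}
    (hF : ContMDiffAt (𝓘(ℂ, EY).prod 𝓘(ℂ, EX)) 𝓘(ℂ, ℂ) ω F (y', x'))
    (hy : y' ∈ (chartAt EY y).source) (hx : x' ∈ (chartAt EX x).source) :
    ContDiffAt ℂ ω (inCharts EY EX F y x) (chartAt EY y y', chartAt EX x x') := by
  rw [contMDiffAt_iff_source_of_mem_source (x := (y, x)) (by simp [hx, hy]),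
    contMDiffWithinAt_iff_contDiffWithinAt] at hF
  simpa [extChartAt_prod, contDiffWithinAt_univ, ModelWithCorners.range_eq_univ_prod] using! hF

theorem ContMDiffAt.slice [IsManifold 𝓘(ℂ, EY) ω Y] [IsManifold 𝓘(ℂ, EX) ω X]
    {F : Y × X → ℂ} {y : Y} {x : X}
    (hF : ContMDiffAt (𝓘(ℂ, EY).prod 𝓘(ℂ, EX)) 𝓘(ℂ, ℂ) ω F (y, x)) :
    ContMDiffAt 𝓘(ℂ, EX) 𝓘(ℂ, ℂ) ω (fun x => F (y, x)) x :=
  ContMDiffAt.comp (I' := 𝓘(ℂ, EY).prod 𝓘(ℂ, EX)) x hF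
    ((contMDiffAt_const (c := y)).prodMk (contMDiffAt_id (x := x)))

/-- The derivative of `F` at `(y, x)` in the direction of `Y`, in the chart at `y`. -/
def fderivY (EY : Type*) [NormedAddCommGroup EY] [NormedSpace ℂ EY] [ChartedSpace EY Y]
    (F : Y × X → ℂ) (y : Y) (x : X) : EY →L[ℂ] ℂ :=
  fderiv ℂ (fun a => F ((chartAt EY y).symm a, x)) (chartAt EY y y)

variable [IsManifold 𝓘(ℂ, EY) ω Y] [IsManifold 𝓘(ℂ, EX) ω X]

theorem eventually_fderivY_eq {F : Y × X → ℂ} {y : Y} {x : X}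
    (hF : ContMDiffAt (𝓘(ℂ, EY).prod 𝓘(ℂ, EX)) 𝓘(ℂ, ℂ) ω F (y, x)) :
    ∀ᶠ q in 𝓝 x, fderivY EY F y q =
      (fderiv ℂ (inCharts EY EX F y x) (chartAt EY y y, chartAt EX x q)).comp
        (ContinuousLinearMap.inl ℂ EY EX) := by
  have h := hF.contDiffAt_inCharts (mem_chart_source EY y) (mem_chart_source EX x)
  have h1 : ∀ᶠ z in 𝓝 (chartAt EY y y, chartAt EX x x),
      DifferentiableAt ℂ (inCharts EY EX F y x) z := by
    filter_upwards [(h.of_le (m := 1) le_top).eventually (by simp)] with z hz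
    exact hz.differentiableAt (by simp)
  have hc : ContinuousAt (fun q => (chartAt EY y y, chartAt EX x q)) x :=
    continuousAt_const.prodMk ((chartAt EX x).continuousAt (mem_chart_source EX x))
  filter_upwards [hc.eventually h1, chart_source_mem_nhds EX x] with q hq hq'
  have hi : HasFDerivAt (fun a : EY => (a, chartAt EX x q)) (ContinuousLinearMap.inl ℂ EY EX)
      (chartAt EY y y) := hasFDerivAt_prodMk_left _ _
  have := (hq.hasFDerivAt.comp (chartAt EY y y) hi).fderiv
  rw [← this, fderivY]
  congr 1
  ext a
  simp [inCharts, (chartAt EX x).left_inv hq']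

theorem contMDiffAt_fderivY {F : Y × X → ℂ} {y : Y} {x : X}
    (hF : ContMDiffAt (𝓘(ℂ, EY).prod 𝓘(ℂ, EX)) 𝓘(ℂ, ℂ) ω F (y, x)) (v : EY) :
    ContMDiffAt 𝓘(ℂ, EX) 𝓘(ℂ, ℂ) ω (fun q => fderivY EY F y q v) x := by
  have h := hF.contDiffAt_inCharts (mem_chart_source EY y) (mem_chart_source EX x)
  have h1 : ContDiffAt ℂ ω (fderiv ℂ (inCharts EY EX F y x)) (chartAt EY y y, chartAt EX x x) :=
    h.fderiv_right (m := ω) (by simp)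
  rw [contMDiffAt_iff_contDiffAt_chart (mem_chart_source EX x)]
  have h2 : ContDiffAt ℂ ω (fun b => fderiv ℂ (inCharts EY EX F y x) (chartAt EY y y, b) (v, 0))
      (chartAt EX x x) :=
    (ContDiffAt.comp (f := fun b => (chartAt EY y y, b)) (chartAt EX x x) h1
      (contDiffAt_const.prodMk contDiffAt_id)).clm_apply contDiffAt_const
  refine h2.congr_of_eventuallyEq ?_
  have hs : ContinuousAt (chartAt EX x).symm (chartAt EX x x) :=
    (chartAt EX x).continuousAt_symm (mem_chart_target EX x)
  have hev := hs.eventually (by simpa using eventually_fderivY_eq hF)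
  filter_upwards [hev, chart_target_mem_nhds EX x] with b hb hb'
  simp [hb, (chartAt EX x).right_inv hb']

theorem tendsto_fderivY {F : Y × X → ℂ} {y : Y} {x : X}
    (hF : ContMDiffAt (𝓘(ℂ, EY).prod 𝓘(ℂ, EX)) 𝓘(ℂ, ℂ) ω F (y, x)) :
    Tendsto (fderivY EY F y) (𝓝 x)
      (𝓝 ((fderiv ℂ (inCharts EY EX F y x) (chartAt EY y y, chartAt EX x x)).comp
        (ContinuousLinearMap.inl ℂ EY EX))) := by
  have h := hF.contDiffAt_inCharts (mem_chart_source EY y) (mem_chart_source EX x)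
  have hc : ContinuousAt (fderiv ℂ (inCharts EY EX F y x)) (chartAt EY y y, chartAt EX x x) :=
    (h.fderiv_right (m := 0) (by simp)).continuousAt
  have hφ : Tendsto (chartAt EX x) (𝓝 x) (𝓝 (chartAt EX x x)) :=
    (chartAt EX x).continuousAt (mem_chart_source EX x)
  have h2 := hc.tendsto.comp ((tendsto_const_nhds (x := chartAt EY y y)).prodMk_nhds hφ)
  have h3 := (ContinuousLinearMap.compL ℂ EY (EY × EX) ℂ).flip
    (ContinuousLinearMap.inl ℂ EY EX) |>.continuous.tendsto _ |>.comp h2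
  exact h3.congr' ((eventually_fderivY_eq hF).mono fun q hq => hq.symm)

theorem isBigO_fderivY {F : Y × X → ℂ} {y : Y} {x : X}
    (hF : ContMDiffAt (𝓘(ℂ, EY).prod 𝓘(ℂ, EX)) 𝓘(ℂ, ℂ) ω F (y, x)) (a₀ : EY) :
    (fun p : EY × X => fderivY EY F y p.2 (p.1 - a₀)) =O[𝓝 a₀ ×ˢ 𝓝 x] fun p => p.1 - a₀ := by
  have h1 := ((tendsto_fderivY hF).comp (tendsto_snd (f := 𝓝 a₀) (g := 𝓝 x))).isBigO_one ℝ
  have h2 := h1.norm_left.mul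
    (Asymptotics.isBigO_refl (fun p : EY × X => ‖p.1 - a₀‖) (𝓝 a₀ ×ˢ 𝓝 x))
  refine Asymptotics.IsBigO.trans (Asymptotics.IsBigO.of_bound 1 ?_)
    (Asymptotics.isBigO_norm_right.1 (h2.congr_right fun p => one_mul _))
  refine Eventually.of_forall fun p => ?_
  rw [norm_mul, norm_norm, norm_norm, one_mul]
  exact ContinuousLinearMap.le_opNorm _ (p.1 - a₀)

/-- Strict differentiability at `(a₀, b₀)`, applied to the pairs `(a, b)`, `(a₀, b)` with the same
second coordinate, gives an error `o(a - a₀)` uniformly in `b` near `b₀`. Replacing the derivative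
at `(a₀, b₀)` by the one at `(a₀, b)` costs an operator tending to `0`, applied to `a - a₀`. -/
theorem isLittleO_sub_fderivY {F : Y × X → ℂ} {y : Y} {x : X}
    (hF : ContMDiffAt (𝓘(ℂ, EY).prod 𝓘(ℂ, EX)) 𝓘(ℂ, ℂ) ω F (y, x)) :
    (fun p : EY × X => F ((chartAt EY y).symm p.1, p.2) - F (y, p.2)
      - fderivY EY F y p.2 (p.1 - chartAt EY y y))
      =o[𝓝 (chartAt EY y y) ×ˢ 𝓝 x] fun p => p.1 - chartAt EY y y := by
  set a₀ := chartAt EY y y with ha₀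
  set b₀ := chartAt EX x x with hb₀
  have h := hF.contDiffAt_inCharts (mem_chart_source EY y) (mem_chart_source EX x)
  have hstrict := h.hasStrictFDerivAt (by simp)
  set G := inCharts EY EX F y x with hG
  have hφ : Tendsto (chartAt EX x) (𝓝 x) (𝓝 b₀) :=
    (chartAt EX x).continuousAt (mem_chart_source EX x)
  have ht : Tendsto (fun p : EY × X => ((p.1, chartAt EX x p.2), (a₀, chartAt EX x p.2)))
      (𝓝 a₀ ×ˢ 𝓝 x) (𝓝 ((a₀, b₀), (a₀, b₀))) := by
    have h2 := hφ.comp (tendsto_snd (f := 𝓝 a₀) (g := 𝓝 x))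
    exact (tendsto_fst.prodMk_nhds h2).prodMk_nhds (tendsto_const_nhds.prodMk_nhds h2)
  have h1 := hstrict.isLittleO.comp_tendsto ht
  have hD : Tendsto (fun p : EY × X => (fderiv ℂ G (a₀, b₀)).comp (ContinuousLinearMap.inl ℂ EY EX)
      - fderivY EY F y p.2) (𝓝 a₀ ×ˢ 𝓝 x) (𝓝 0) := by
    have h5 := (tendsto_const_nhds (x := (fderiv ℂ G (a₀, b₀)).comp
      (ContinuousLinearMap.inl ℂ EY EX))).sub
      ((tendsto_fderivY hF).comp (tendsto_snd (f := 𝓝 a₀) (g := 𝓝 x)))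
    rw [← hG, ← ha₀, ← hb₀, sub_self] at h5
    exact h5
  have h2 : (fun p : EY × X => ((fderiv ℂ G (a₀, b₀)).comp (ContinuousLinearMap.inl ℂ EY EX)
      - fderivY EY F y p.2) (p.1 - a₀)) =o[𝓝 a₀ ×ˢ 𝓝 x] fun p => p.1 - a₀ := by
    have h3 := ((Asymptotics.isLittleO_one_iff ℝ).2 hD).norm_left.mul_isBigO
      (Asymptotics.isBigO_refl (fun p : EY × X => ‖p.1 - a₀‖) (𝓝 a₀ ×ˢ 𝓝 x))
    refine Asymptotics.IsBigO.trans_isLittleO (Asymptotics.IsBigO.of_bound 1 ?_)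
      (Asymptotics.isLittleO_norm_right.1 (h3.congr_right fun p => one_mul _))
    refine Eventually.of_forall fun p => ?_
    rw [norm_mul, norm_norm, norm_norm, one_mul]
    exact ContinuousLinearMap.le_opNorm _ (p.1 - a₀)
  have h1' : (fun p : EY × X => G (p.1, chartAt EX x p.2) - G (a₀, chartAt EX x p.2)
      - fderiv ℂ G (a₀, b₀) (p.1 - a₀, 0)) =o[𝓝 a₀ ×ˢ 𝓝 x] fun p => p.1 - a₀ := by
    refine (h1.congr_left (f₂ := fun p : EY × X => G (p.1, chartAt EX x p.2)
      - G (a₀, chartAt EX x p.2) - fderiv ℂ G (a₀, b₀) (p.1 - a₀, 0)) fun p => ?_).trans_isBigO (Asymptotics.IsBigO.of_bound 1 ?_)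
    · change _ - _ - fderiv ℂ G (a₀, b₀) ((_, _) - (_, _)) = _
      rw [Prod.mk_sub_mk, sub_self]
    · refine Eventually.of_forall fun p => ?_
      simp
  refine (h1'.add h2).congr' ?_ EventuallyEq.rfl
  filter_upwards [tendsto_snd.eventually (chart_source_mem_nhds EX x)] with p hp
  simp [hG, inCharts, (chartAt EX x).left_inv hp, ha₀]

end Product

/-! ### Change of frame for `log h(e, e)` and its (1,0)-differential -/

section MetricTransition

variable {E H : Type*} [NormedAddCommGroup E] [NormedSpace ℂ E] [TopologicalSpace H]
  {I : ModelWithCorners ℂ E H} {M : Type*} [TopologicalSpace M] [ChartedSpace H M]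

namespace HermitianMetric

variable {L : HolLineBundle I M} (h : HermitianMetric L)

/-- The function `log h(e, e)` on `M`, for the local holomorphic frame `e` around `p`. -/
def logNorm (p q : M) : ℝ := Real.log (h.inner q (L.frame p q) (L.frame p q)).re

/-- If `e_p = g e_{p'}`, sesquilinearity gives `h(e_p, e_p) = |g|² h(e_{p'}, e_{p'})`. -/
theorem logNorm_eq_add {p p' q : M} (hq : q ∈ L.base p) (hq' : q ∈ L.base p') :
    h.logNorm p q = h.logNorm p' q + Real.log (‖L.transition p p' q‖ ^ 2) := by
  have h1 := h.pos q _ (HolLineBundle.frame_ne_zero hq')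
  have h2 : h.inner q (L.frame p q) (L.frame p q) =
      ((‖L.transition p p' q‖ ^ 2 : ℝ) : ℂ) * h.inner q (L.frame p' q) (L.frame p' q) := by
    rw [HolLineBundle.frame_eq (p := p) hq']
    simp only [map_smulₛₗ, LinearMap.smul_apply, smul_eq_mul, RingHom.id_apply]
    rw [← mul_assoc, mul_comm (L.transition p p' q), ← Complex.normSq_eq_conj_mul_self,
      Complex.normSq_eq_norm_sq]
  have h3 := HolLineBundle.transition_ne_zero hq hq'
  rw [logNorm, h2, Complex.re_ofReal_mul, Real.log_mul (by positivity) h1.ne', add_comm]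
  rfl

end HermitianMetric

/-- The value on `v` of the `(1,0)`-part of the differential of `g` at `a`. -/
def flatPartial (g : E → ℝ) (a v : E) : ℂ :=
  (fderiv ℝ g a v - Complex.I * fderiv ℝ g a (Complex.I • v)) / 2

theorem flatPartial_add {g k : E → ℝ} {a : E} (hg : DifferentiableAt ℝ g a)
    (hk : DifferentiableAt ℝ k a) (v : E) :
    flatPartial (fun u => g u + k u) a v = flatPartial g a v + flatPartial k a v := by
  simp only [flatPartial, fderiv_fun_add hg hk, add_apply, Complex.ofReal_add]
  ring

theorem flatPartial_map_add (g : E → ℝ) (a v w : E) :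
    flatPartial g a (v + w) = flatPartial g a v + flatPartial g a w := by
  simp only [flatPartial, smul_add, map_add, Complex.ofReal_add]
  ring

theorem flatPartial_map_smul (g : E → ℝ) (a : E) (c : ℂ) (v : E) :
    flatPartial g a (c • v) = c * flatPartial g a v := by
  have key : ∀ (c : ℂ) (ξ : E), fderiv ℝ g a (c • ξ)
      = c.re * fderiv ℝ g a ξ + c.im * fderiv ℝ g a (Complex.I • ξ) := by
    intro c ξ
    have : c • ξ = c.re • ξ + c.im • (Complex.I • ξ) := by
      conv_lhs => rw [← Complex.re_add_im c]
      rw [add_smul, mul_smul, Complex.coe_smul, Complex.coe_smul]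
    rw [this, map_add, map_smul, map_smul]
    simp
  have h1 := key c v
  have h2 := key c (Complex.I • v)
  rw [smul_smul Complex.I Complex.I v, Complex.I_mul_I, neg_one_smul, map_neg] at h2
  simp only [flatPartial]
  rw [smul_comm Complex.I c v, h1, h2]
  have hc : c = c.re + c.im * Complex.I := (Complex.re_add_im c).symm
  push_cast
  generalize hp : (fderiv ℝ g a v : ℂ) = p
  generalize hr : (fderiv ℝ g a (Complex.I • v) : ℂ) = r
  conv_rhs => rw [hc]
  linear_combination (1 / 2 * c.im * r) * Complex.I_sq

theorem differentiableAt_log_norm_sq {c : E → ℂ} {a : E} (hc : DifferentiableAt ℂ c a)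
    (h0 : c a ≠ 0) : DifferentiableAt ℝ (fun u => Real.log (‖c u‖ ^ 2)) a :=
  ((hc.restrictScalars ℝ).norm_sq ℝ).log (by positivity)

/-- Formally `log |c|² = log c + log c̄` and `∂` kills the second term. The computation avoids
branches of the logarithm: with `w = dc(v)`, the derivatives of `|c|²` along `v` and `iv` are `2
Re(c̄w)` and `-2 Im(c̄w)`, which recombine to `c̄w / |c|² = w / c`. -/
theorem flatPartial_log_norm_sq {c : E → ℂ} {a : E} (hc : DifferentiableAt ℂ c a)
    (h0 : c a ≠ 0) (v : E) :
    flatPartial (fun u => Real.log (‖c u‖ ^ 2)) a v = fderiv ℂ c a v / c a := by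
  have h1 := (hc.hasFDerivAt.restrictScalars ℝ).norm_sq.log (by positivity)
  have hn : (‖c a‖ ^ 2 : ℂ) = c a * conj (c a) := by
    rw [Complex.mul_conj, Complex.normSq_eq_norm_sq]; push_cast; rfl
  have hn' : (‖c a‖ : ℂ) ≠ 0 := by simpa using h0
  rw [flatPartial, h1.fderiv]
  simp only [smul_apply, ContinuousLinearMap.comp_apply, ContinuousLinearMap.coe_restrictScalars',
    innerSL_apply_apply, Complex.inner, map_smul, smul_eq_mul]
  set w := fderiv ℂ c a v
  have e1 : ((conj (c a) * (Complex.I * w)).re : ℂ) = -((conj (c a) * w).im : ℂ) := by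
    rw [← Complex.ofReal_neg]; congr 1; simp; ring
  have e2 := Complex.re_add_im (conj (c a) * w)
  simp only [nsmul_eq_mul, Complex.ofReal_mul, mul_comm w, mul_comm (Complex.I * w), e1]
  push_cast
  rw [hn, eq_div_iff h0]
  have h0' : conj (c a) ≠ 0 := by simpa using h0
  field_simp
  linear_combination e2

end MetricTransition

/-! ### The Chern connection form along `Y` and the contracted curvature -/

section MetricFamily

variable {EY EX Y X : Type*} [NormedAddCommGroup EY] [NormedSpace ℂ EY]
  [NormedAddCommGroup EX] [NormedSpace ℂ EX]
  [TopologicalSpace Y] [ChartedSpace EY Y]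
  [TopologicalSpace X] [ChartedSpace EX X]
  {L : HolLineBundle (𝓘(ℂ, EY).prod 𝓘(ℂ, EX)) (Y × X)} (h : HermitianMetric L)

namespace HermitianMetric

theorem contDiffAt_logNormSq (p : Y × X) :
    ContDiffAt ℝ ∞ (h.logNormSq p) (extChartAt (𝓘(ℂ, EY).prod 𝓘(ℂ, EX)) p p) := by
  refine (h.smooth p).log ?_
  rw [extChartAt_to_inv]
  exact (h.pos p _ (HolLineBundle.frame_ne_zero (L.mem_base_self p))).ne'

theorem logNormSq_apply (y : Y) (x : X) (z : EY × EX) :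
    h.logNormSq (y, x) z = inCharts EY EX (h.logNorm (y, x)) y x z := rfl

theorem contDiffAt_inCharts_logNorm (y : Y) (x : X) :
    ContDiffAt ℝ ∞ (inCharts EY EX (h.logNorm (y, x)) y x) (chartAt EY y y, chartAt EX x x) := by
  have h1 := h.contDiffAt_logNormSq (y, x)
  rw [show h.logNormSq (y, x) = inCharts EY EX (h.logNorm (y, x)) y x from
    funext (h.logNormSq_apply y x)] at h1
  simpa [extChartAt_prod] using h1

/-- The value on `v ∈ T_y Y` of the Chern connection form `∂ log h(e, e)` at `(y, x)`, for the local
holomorphic frame `e` around `p`. -/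
def chernFormY (p : Y × X) (y : Y) (v : EY) (x : X) : ℂ :=
  flatPartial (fun a => h.logNorm p ((chartAt EY y).symm a, x)) (chartAt EY y y) v

theorem eventually_slice_mem_base {p : Y × X} {y : Y} {x : X} (hp : (y, x) ∈ L.base p) :
    ∀ᶠ a in 𝓝 (chartAt EY y y), ((chartAt EY y).symm a, x) ∈ L.base p := by
  have h1 : ContinuousAt (fun a => ((chartAt EY y).symm a, x)) (chartAt EY y y) :=
    ((chartAt EY y).continuousAt_symm (mem_chart_target EY y)).prodMk continuousAt_const
  exact h1.eventually_mem ((L.isOpen_base p).mem_nhds (by simpa using hp))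

theorem chernFormY_add (p : Y × X) (y : Y) (v w : EY) (x : X) :
    h.chernFormY p y (v + w) x = h.chernFormY p y v x + h.chernFormY p y w x :=
  flatPartial_map_add _ _ _ _

theorem chernFormY_smul (p : Y × X) (y : Y) (c : ℂ) (v : EY) (x : X) :
    h.chernFormY p y (c • v) x = c * h.chernFormY p y v x :=
  flatPartial_map_smul _ _ _ _

theorem chernForm_apply (p : Y × X) (z w : EY × EX) :
    h.chernForm p z w = flatPartial (h.logNormSq p) z w := by
  simp [chernForm, flatPartial]
  ring

theorem contDiffAt_chernForm (y : Y) (x : X) :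
    ContDiffAt ℝ ∞ (h.chernForm (y, x)) (chartAt EY y y, chartAt EX x x) := by
  have h1 := h.contDiffAt_logNormSq (y, x)
  rw [show extChartAt (𝓘(ℂ, EY).prod 𝓘(ℂ, EX)) (y, x) (y, x) = (chartAt EY y y, chartAt EX x x) by
    simp] at h1
  have h2 : ContDiffAt ℝ ∞ (fderiv ℝ (h.logNormSq (y, x))) (chartAt EY y y, chartAt EX x x) :=
    h1.fderiv_right (by simp)
  have h3 : ContDiffAt ℝ ∞ (fun z => Complex.ofRealCLM ∘L fderiv ℝ (h.logNormSq (y, x)) z)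
      (chartAt EY y y, chartAt EX x x) := contDiffAt_const.clm_comp h2
  have h4 : ContDiffAt ℝ ∞ (fun z => Complex.ofRealCLM ∘L fderiv ℝ (h.logNormSq (y, x)) z ∘L
      (Complex.I • ContinuousLinearMap.id ℝ (EY × EX)))
      (chartAt EY y y, chartAt EX x x) := contDiffAt_const.clm_comp (h2.clm_comp contDiffAt_const)
  exact (h3.sub (h4.const_smul Complex.I)).const_smul (1 / 2 : ℂ)

theorem eventually_chernFormY_eq (y : Y) (x : X) :
    ∀ᶠ b in 𝓝 (chartAt EX x x), ∀ v, h.chernFormY (y, x) y v ((chartAt EX x).symm b)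
      = h.chernForm (y, x) (chartAt EY y y, b) (v, 0) := by
  have h1 := h.contDiffAt_inCharts_logNorm y x
  have h2 : ∀ᶠ z in 𝓝 (chartAt EY y y, chartAt EX x x),
      DifferentiableAt ℝ (inCharts EY EX (h.logNorm (y, x)) y x) z := by
    filter_upwards [(h1.of_le (m := 1) (by simp)).eventually (by simp)] with z hz
    exact hz.differentiableAt (by simp)
  have hc : ContinuousAt (fun b => (chartAt EY y y, b)) (chartAt EX x x) :=
    continuousAt_const.prodMk continuousAt_id
  filter_upwards [hc.eventually h2] with b hb v
  have hi : HasFDerivAt (fun a : EY => (a, b)) (ContinuousLinearMap.inl ℝ EY EX)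
      (chartAt EY y y) := hasFDerivAt_prodMk_left _ _
  have h3 := (hb.hasFDerivAt.comp (chartAt EY y y) hi).fderiv
  have h4 : (fun a => h.logNorm (y, x) ((chartAt EY y).symm a, (chartAt EX x).symm b)) =
    inCharts EY EX (h.logNorm (y, x)) y x ∘ fun a : EY => (a, b) := rfl
  rw [chernForm_apply, chernFormY, flatPartial, h4, h3, flatPartial,
    show h.logNormSq (y, x) = _ from funext (h.logNormSq_apply y x)]
  simp

theorem eventually_mem_base_slice {p : Y × X} {y : Y} {x : X} (hp : (y, x) ∈ L.base p) :
    ∀ᶠ q in 𝓝 x, (y, q) ∈ L.base p := by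
  have h1 : ContinuousAt (fun q : X => (y, q)) x := continuousAt_const.prodMk continuousAt_id
  exact h1.eventually_mem ((L.isOpen_base p).mem_nhds hp)

variable [IsManifold 𝓘(ℂ, EX) ω X]

/-- Smoothness of a metric is given at `(y, x)` only for the frame centred there;
`contMDiffAt_chernFormY` treats the other frames by comparison with this one. -/
theorem contMDiffAt_chernFormY_self (y : Y) (v : EY) (x : X) :
    ContMDiffAt 𝓘(ℝ, EX) 𝓘(ℝ, ℂ) ∞ (h.chernFormY (y, x) y v) x := by
  have := isManifold_real (E := EX) (X := X) ∞
  rw [contMDiffAt_iff_contDiffAt_chart (mem_chart_source EX x)]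
  have h2 : ContDiffAt ℝ ∞ (fun b => h.chernForm (y, x) (chartAt EY y y, b) (v, 0))
      (chartAt EX x x) :=
    (ContDiffAt.comp (f := fun b => (chartAt EY y y, b)) (chartAt EX x x)
      (h.contDiffAt_chernForm y x) (contDiffAt_const.prodMk contDiffAt_id)).clm_apply
      contDiffAt_const
  refine h2.congr_of_eventuallyEq ?_
  filter_upwards [h.eventually_chernFormY_eq y x] with b hb
  exact hb v

/-- `F(v, ξ)` is the derivative of `θ(ξ)` along `v` minus the derivative of `θ(v)` along `ξ`. Taking
the (0,1)-part in `ξ` removes the first term, since `θ` has type (1,0), and turns the second into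
`-∂̄(θ(v))`. -/
theorem contraction01_eq_neg_dbar_self (y : Y) (v : EY) (x : X) (ξ : EX) :
    h.contraction01 y v x ξ = -dbar EX (h.chernFormY (y, x) y v) x ξ := by
  have hcon : h.contraction01 y v x ξ = (h.curvature (y, x) ((v, 0) : EY × EX) ((0, ξ) : EY × EX)
    + Complex.I * h.curvature (y, x) ((v, 0) : EY × EX) ((0, Complex.I • ξ) : EY × EX)) / 2 := rfl
  have hθ := ((h.contDiffAt_chernForm y x).differentiableAt (by simp)).hasFDerivAt
  set θ := h.chernForm (y, x) with hθdef
  set z₀ : EY × EX := (chartAt EY y y, chartAt EX x x) with hz₀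
  have hz : extChartAt (𝓘(ℂ, EY).prod 𝓘(ℂ, EX)) (y, x) (y, x) = z₀ := by simp [hz₀]
  have hcurv : ∀ u w : EY × EX, h.curvature (y, x) u w = fderiv ℝ θ z₀ u w - fderiv ℝ θ z₀ w u :=
    fun u w => by rw [← hz]; rfl
  have hap : ∀ w : EY × EX, HasFDerivAt (fun z => θ z w) ((fderiv ℝ θ z₀).flip w) z₀ := fun w => by
    simpa using hθ.clm_apply (hasFDerivAt_const w z₀)
  -- The relation `θ(w) + i θ(iw) = 0` holds at all points of the model space, so it may be
  -- differentiated in the direction `(v, 0)`.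
  have htype : ∀ w : EY × EX, fderiv ℝ θ z₀ (v, 0) w
      + Complex.I * fderiv ℝ θ z₀ (v, 0) (Complex.I • w) = 0 := by
    intro w
    have h1 := (hap w).add ((hap (Complex.I • w)).const_mul Complex.I)
    have h2 : (fun z => θ z w + Complex.I * θ z (Complex.I • w)) = fun _ => 0 := by
      funext z
      rw [hθdef, chernForm_apply, chernForm_apply, flatPartial_map_smul]
      linear_combination flatPartial (h.logNormSq (y, x)) z w * Complex.I_sq
    have h3 : HasFDerivAt (fun z => θ z w + Complex.I * θ z (Complex.I • w)) _ z₀ := h1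
    rw [h2] at h3
    have h4 := congrArg (fun l => l (v, 0)) (h3.unique (hasFDerivAt_const _ _))
    simpa using h4
  have hi : HasFDerivAt (fun b : EX => (chartAt EY y y, b)) (ContinuousLinearMap.inr ℝ EY EX)
      (chartAt EX x x) := hasFDerivAt_prodMk_right _ _
  have hG : (h.chernFormY (y, x) y v ∘ (chartAt EX x).symm) =ᶠ[𝓝 (chartAt EX x x)]
      fun b => θ (chartAt EY y y, b) (v, 0) := by
    filter_upwards [h.eventually_chernFormY_eq y x] with b hb
    exact hb v
  have hd : fderiv ℝ (h.chernFormY (y, x) y v ∘ (chartAt EX x).symm) (chartAt EX x x)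
      = ((fderiv ℝ θ z₀).flip (v, 0)).comp (ContinuousLinearMap.inr ℝ EY EX) := by
    rw [hG.fderiv_eq]
    exact (HasFDerivAt.comp (chartAt EX x x) (hap (v, 0)) hi).fderiv
  rw [dbar_eq_flatDbar ((h.contMDiffAt_chernFormY_self y v x).mdifferentiableAt (by simp)),
    flatDbar, hd, hcon, hcurv, hcurv]
  have h5 := htype (0, ξ)
  simp only [Prod.smul_mk, smul_zero] at h5
  simp only [ContinuousLinearMap.comp_apply, ContinuousLinearMap.inr_apply,
    ContinuousLinearMap.flip_apply]
  linear_combination (1 / 2) * h5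

variable [IsManifold 𝓘(ℂ, EY) ω Y]

theorem _root_.ContMDiffAt.differentiableAt_slice {F : Y × X → ℂ} {y : Y} {x : X}
    (hF : ContMDiffAt (𝓘(ℂ, EY).prod 𝓘(ℂ, EX)) 𝓘(ℂ, ℂ) ω F (y, x)) :
    DifferentiableAt ℂ (fun a => F ((chartAt EY y).symm a, x)) (chartAt EY y y) := by
  have h1 := hF.contDiffAt_inCharts (mem_chart_source EY y) (mem_chart_source EX x)
  have h2 : DifferentiableAt ℂ (fun a : EY => (a, chartAt EX x x)) (chartAt EY y y) := by fun_prop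
  have h3 := DifferentiableAt.comp (chartAt EY y y) (h1.differentiableAt (by simp)) h2
  simpa [Function.comp_def, inCharts] using h3

theorem differentiableAt_logNorm_slice {p : Y × X} {y : Y} {x : X} (hp : (y, x) ∈ L.base p) :
    DifferentiableAt ℝ (fun a => h.logNorm p ((chartAt EY y).symm a, x)) (chartAt EY y y) := by
  have h1 : DifferentiableAt ℝ (fun a => h.logNorm (y, x) ((chartAt EY y).symm a, x))
      (chartAt EY y y) := by
    have h2 : DifferentiableAt ℝ (fun a : EY => (a, chartAt EX x x)) (chartAt EY y y) := by fun_prop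
    have h3 := DifferentiableAt.comp (chartAt EY y y)
      ((h.contDiffAt_inCharts_logNorm y x).differentiableAt (by simp)) h2
    simpa [Function.comp_def, inCharts] using h3
  have hx := L.mem_base_self (y, x)
  have h2 := differentiableAt_log_norm_sq
    (HolLineBundle.contMDiffAt_transition hp hx).differentiableAt_slice
    (by simpa using HolLineBundle.transition_ne_zero hp hx)
  refine (h1.add h2).congr_of_eventuallyEq ?_
  filter_upwards [eventually_slice_mem_base hp, eventually_slice_mem_base hx] with a ha ha'
  exact h.logNorm_eq_add ha ha'

/-- Gauge change of the Chern connection: for `e_p = g e_{p'}` the forms differ by `∂ log |g|² = dg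
/ g`. -/
theorem chernFormY_eq_add {p p' : Y × X} {y : Y} {x : X} (hp : (y, x) ∈ L.base p)
    (hp' : (y, x) ∈ L.base p') (v : EY) :
    h.chernFormY p y v x = h.chernFormY p' y v x
      + fderivY EY (L.transition p p') y x v / L.transition p p' (y, x) := by
  have hc := (HolLineBundle.contMDiffAt_transition hp hp').differentiableAt_slice
  have h0 : L.transition p p' ((chartAt EY y).symm (chartAt EY y y), x) ≠ 0 := by
    simpa using HolLineBundle.transition_ne_zero hp hp'
  have h1 : (fun a => h.logNorm p ((chartAt EY y).symm a, x)) =ᶠ[𝓝 (chartAt EY y y)]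
      fun a => h.logNorm p' ((chartAt EY y).symm a, x)
        + Real.log (‖L.transition p p' ((chartAt EY y).symm a, x)‖ ^ 2) := by
    filter_upwards [eventually_slice_mem_base hp, eventually_slice_mem_base hp'] with a ha ha'
    exact h.logNorm_eq_add ha ha'
  have h2 := flatPartial_log_norm_sq hc h0 v
  have h3 : h.chernFormY p y v x = flatPartial (fun a => h.logNorm p' ((chartAt EY y).symm a, x)
        + Real.log (‖L.transition p p' ((chartAt EY y).symm a, x)‖ ^ 2)) (chartAt EY y y) v := by
    rw [chernFormY, flatPartial, h1.fderiv_eq, flatPartial]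
  rw [h3, flatPartial_add (h.differentiableAt_logNorm_slice hp')
    (differentiableAt_log_norm_sq hc h0), h2]
  simp [chernFormY, fderivY]

theorem _root_.HolLineBundle.contMDiffAt_fderivY_transition_div {p p' : Y × X} {y : Y} {x : X}
    (hp : (y, x) ∈ L.base p) (hp' : (y, x) ∈ L.base p') (v : EY) :
    ContMDiffAt 𝓘(ℂ, EX) 𝓘(ℂ, ℂ) ω
      (fun q => fderivY EY (L.transition p p') y q v / L.transition p p' (y, q)) x :=
  (contMDiffAt_fderivY (HolLineBundle.contMDiffAt_transition hp hp') v).div₀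
    (HolLineBundle.contMDiffAt_transition hp hp').slice (HolLineBundle.transition_ne_zero hp hp')

theorem eventually_chernFormY_eq_add {p p' : Y × X} {y : Y} {x : X} (hp : (y, x) ∈ L.base p)
    (hp' : (y, x) ∈ L.base p') (v : EY) :
    h.chernFormY p y v =ᶠ[𝓝 x] fun q => h.chernFormY p' y v q
      + fderivY EY (L.transition p p') y q v / L.transition p p' (y, q) := by
  filter_upwards [eventually_mem_base_slice hp, eventually_mem_base_slice hp'] with q hq hq'
  exact h.chernFormY_eq_add hq hq' v

theorem contMDiffAt_chernFormY {p : Y × X} {y : Y} {x : X} (hp : (y, x) ∈ L.base p) (v : EY) :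
    ContMDiffAt 𝓘(ℝ, EX) 𝓘(ℝ, ℂ) ∞ (h.chernFormY p y v) x := by
  have hx := L.mem_base_self (y, x)
  refine ContMDiffAt.congr_of_eventuallyEq ?_ (h.eventually_chernFormY_eq_add hp hx v)
  exact (h.contMDiffAt_chernFormY_self y v x).add
    ((HolLineBundle.contMDiffAt_fderivY_transition_div hp hx v).restrictScalars_real.of_le le_top)

/-- The two connection forms differ by a function holomorphic in `x`. Since the curvature is
computed at each point in the frame centred there, this is what allows a single frame to serve on a
whole neighbourhood. -/
theorem dbar_chernFormY_eq {p p' : Y × X} {y : Y} {x : X} (hp : (y, x) ∈ L.base p)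
    (hp' : (y, x) ∈ L.base p') (v : EY) (ξ : EX) :
    dbar EX (h.chernFormY p y v) x ξ = dbar EX (h.chernFormY p' y v) x ξ := by
  have h1 := HolLineBundle.contMDiffAt_fderivY_transition_div hp hp' v
  rw [dbar_congr (h.eventually_chernFormY_eq_add hp hp' v),
    dbar_add ((h.contMDiffAt_chernFormY hp' v).mdifferentiableAt (by simp))
      (h1.restrictScalars_real.mdifferentiableAt (by simp)),
    dbar_of_holomorphic (h1.mdifferentiableAt (by simp)), add_zero]

theorem contraction01_eq_neg_dbar {p : Y × X} {y : Y} {x : X} (hp : (y, x) ∈ L.base p) (v : EY)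
    (ξ : EX) : h.contraction01 y v x ξ = -dbar EX (h.chernFormY p y v) x ξ := by
  rw [contraction01_eq_neg_dbar_self, h.dbar_chernFormY_eq (L.mem_base_self _) hp]

theorem locallyExact_contraction01 (y : Y) (v : EY) :
    LocallyExact (fun p : TangentBundle 𝓘(ℂ, EX) X => h.contraction01 y v p.1 p.2) := by
  intro x
  have hx := L.mem_base_self (y, x)
  refine ⟨fun q => (-1) * h.chernFormY (y, x) y v q,
    (ContinuousLinearMap.mul ℝ ℂ (-1)).contMDiff.contMDiffAt.comp x
      (h.contMDiffAt_chernFormY hx v), ?_⟩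
  filter_upwards [eventually_mem_base_slice hx] with q hq ξ
  have h1 := h.contraction01_eq_neg_dbar hq v ξ
  have h2 := dbar_smul ((h.contMDiffAt_chernFormY hq v).mdifferentiableAt (by simp)) (-1) ξ
  exact h1.trans (by rw [← neg_one_mul]; exact h2.symm)

theorem contraction01_add (y : Y) (v w : EY) (x : X) (ξ : EX) :
    h.contraction01 y (v + w) x ξ = h.contraction01 y v x ξ + h.contraction01 y w x ξ := by
  simp only [contraction01_eq_neg_dbar_self]
  have h1 := fun v => (h.contMDiffAt_chernFormY_self y v x).mdifferentiableAt (by simp)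
  rw [show h.chernFormY (y, x) y (v + w) = _ from funext (h.chernFormY_add _ _ _ _),
    dbar_add (h1 v) (h1 w)]
  ring

theorem contraction01_smul (y : Y) (c : ℂ) (v : EY) (x : X) (ξ : EX) :
    h.contraction01 y (c • v) x ξ = c * h.contraction01 y v x ξ := by
  simp only [contraction01_eq_neg_dbar_self]
  have h1 := (h.contMDiffAt_chernFormY_self y v x).mdifferentiableAt (by simp)
  rw [show h.chernFormY (y, x) y (c • v) = _ from funext (h.chernFormY_smul _ _ _ _),
    dbar_smul h1]
  ring

/-- The linear map which sends `v ∈ T_y Y` to the `(0,1)`-part of the contraction of the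
curvature with `v`. -/
def contractionMap (y : Y) : EY →ₗ[ℂ] Z01 EX X where
  toFun v := (h.locallyExact_contraction01 y v).toZ01
  map_add' v w := by
    refine Subtype.ext (ContinuousMap.ext (X := TangentBundle 𝓘(ℂ, EX) X) (Y := ℂ) fun p => ?_)
    exact h.contraction01_add y v w p.1 p.2
  map_smul' c v := by
    refine Subtype.ext (ContinuousMap.ext (X := TangentBundle 𝓘(ℂ, EX) X) (Y := ℂ) fun p => ?_)
    exact h.contraction01_smul y c v p.1 p.2

end HermitianMetric

end MetricFamily

/-! ### The glued smooth isomorphism `L_y → L_{y'}` and the form it transports -/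

section Trivialization

universe w

variable {EY EX Y X : Type*} [NormedAddCommGroup EY] [NormedSpace ℂ EY]
  [NormedAddCommGroup EX] [NormedSpace ℂ EX]
  [TopologicalSpace Y] [ChartedSpace EY Y]
  [TopologicalSpace X] [ChartedSpace EX X]

/-- A finite smooth partition of unity on `X` subordinate to the domains of the local
holomorphic frames of `L` around points of `{y} × X`. -/
structure FramePartition (L : HolLineBundle.{_, _, _, w} (𝓘(ℂ, EY).prod 𝓘(ℂ, EX)) (Y × X))
    (y : Y) where
  centers : Finset X
  toFun : X → X → ℂ
  contMDiff : ∀ c, ContMDiff 𝓘(ℝ, EX) 𝓘(ℝ, ℂ) ∞ (toFun c)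
  sum_eq_one : ∀ x, ∑ c ∈ centers, toFun c x = 1
  mem_base : ∀ c x, x ∈ tsupport (toFun c) → (y, x) ∈ L.base (y, c)

theorem exists_framePartition [IsManifold 𝓘(ℂ, EX) ω X] [FiniteDimensional ℂ EX] [T2Space X]
    [CompactSpace X] (L : HolLineBundle.{_, _, _, w} (𝓘(ℂ, EY).prod 𝓘(ℂ, EX)) (Y × X)) (y : Y) :
    Nonempty (FramePartition L y) := by
  have := isManifold_real (E := EX) (X := X) ∞
  have : FiniteDimensional ℝ EX := FiniteDimensional.complexToReal EX
  obtain ⟨f, hf⟩ := SmoothPartitionOfUnity.exists_isSubordinate 𝓘(ℝ, EX) (isClosed_univ (X := X))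
    (fun c => {q | (y, q) ∈ L.base (y, c)})
    (fun c => (L.isOpen_base (y, c)).preimage (by fun_prop))
    (fun x _ => Set.mem_iUnion.2 ⟨x, L.mem_base_self (y, x)⟩)
  have hfin := f.locallyFinite.finite_nonempty_of_compact
  have hsupp : ∀ c, Function.support (fun x => (f c x : ℂ)) = Function.support (f c) := by
    intro c; ext x; simp
  refine ⟨⟨hfin.toFinset, fun c x => f c x, fun c => ?_, fun x => ?_, fun c x hx => ?_⟩⟩
  · exact Complex.ofRealCLM.contMDiff.comp (f c).contMDiff
  · have h1 := f.sum_eq_one (Set.mem_univ x)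
    rw [finsum_eq_sum_of_support_subset (s := hfin.toFinset)] at h1
    · exact_mod_cast h1
    · intro c hc
      exact hfin.mem_toFinset.2 ⟨x, hc⟩
  · rw [tsupport, hsupp] at hx
    exact hf c hx

namespace FramePartition

variable {L : HolLineBundle.{_, _, _, w} (𝓘(ℂ, EY).prod 𝓘(ℂ, EX)) (Y × X)} {y : Y}
  (P : FramePartition L y)

/-- The coefficient, in the frames around `p` and `p'`, of the isomorphism from the fibre at
`(y, x)` to the fibre at `(y', x)` which fixes the local frame around `(y, c)`. -/
def ratio (_P : FramePartition L y) (p p' : Y × X) (y' : Y) (c x : X) : ℂ :=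
  L.transition (y, c) p' (y', x) * L.transition p (y, c) (y, x)

/-- The coefficient, in the frames around `p` and `p'`, of the smooth homomorphism from
`L_y` to `L_{y'}` glued from the local frames. -/
def mult (p p' : Y × X) (y' : Y) (x : X) : ℂ :=
  ∑ c ∈ P.centers, P.toFun c x * P.ratio p p' y' c x

/-- The value on `ξ` of the form `∂̄` of `mult`. -/
def dbarMult (p p' : Y × X) (y' : Y) (x : X) (ξ : EX) : ℂ :=
  ∑ c ∈ P.centers, dbar EX (P.toFun c) x ξ * P.ratio p p' y' c x

/-- The local frames used by the partition of unity extend from `y` to `y'`. -/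
def Extends (y' : Y) (x : X) : Prop :=
  ∀ c ∈ P.centers, x ∈ tsupport (P.toFun c) → (y', x) ∈ L.base (y, c)

/-- The homomorphism from `L_y` to `L_{y'}` is defined and invertible. -/
def Good (y' : Y) : Prop :=
  ∀ x, P.Extends y' x ∧ P.mult (y, x) (y', x) y' x ≠ 0

theorem toFun_eq_zero {c x : X} (hx : x ∉ tsupport (P.toFun c)) : P.toFun c x = 0 :=
  image_eq_zero_of_notMem_tsupport hx

theorem toFun_eventuallyEq_zero {c x : X} (hx : x ∉ tsupport (P.toFun c)) :
    P.toFun c =ᶠ[𝓝 x] fun _ => 0 :=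
  notMem_tsupport_iff_eventuallyEq.1 hx

theorem dbar_toFun_eq_zero {c x : X} (hx : x ∉ tsupport (P.toFun c)) (ξ : EX) :
    dbar EX (P.toFun c) x ξ = 0 := by
  rw [dbar_congr (P.toFun_eventuallyEq_zero hx), dbar_const]

theorem mdifferentiableAt (c x : X) : MDifferentiableAt 𝓘(ℝ, EX) 𝓘(ℝ, ℂ) (P.toFun c) x :=
  (P.contMDiff c).mdifferentiableAt (by simp)

theorem sum_dbar_toFun (x : X) (ξ : EX) : ∑ c ∈ P.centers, dbar EX (P.toFun c) x ξ = 0 := by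
  rw [← dbar_sum fun c _ => P.mdifferentiableAt c x, show (fun q => ∑ c ∈ P.centers, P.toFun c q)
    = fun _ => 1 from funext P.sum_eq_one, dbar_const]

/-- Cocycle relation. On the support the frame around `(y, c)` is defined at `(y, x)`; elsewhere
`ratio` may take meaningless values, but it only ever appears multiplied by `toFun c` or its `∂̄`,
which vanish there. -/
theorem ratio_change {p p' q q' : Y × X} {y' : Y} {c x : X}
    (hc : x ∈ tsupport (P.toFun c)) (hq : (y, x) ∈ L.base q)
    (hp' : (y', x) ∈ L.base p') (hq' : (y', x) ∈ L.base q') :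
    P.ratio p p' y' c x =
      L.transition p q (y, x) * L.transition q' p' (y', x) * P.ratio q q' y' c x := by
  rw [ratio, ratio, ← HolLineBundle.transition_mul (p := (y, c)) hq' hp',
    ← HolLineBundle.transition_mul (p := p) hq (P.mem_base c x hc)]
  ring

theorem mult_change {p p' q q' : Y × X} {y' : Y} {x : X} (hq : (y, x) ∈ L.base q)
    (hp' : (y', x) ∈ L.base p') (hq' : (y', x) ∈ L.base q') :
    P.mult p p' y' x = L.transition p q (y, x) * L.transition q' p' (y', x) * P.mult q q' y' x := by
  rw [mult, mult, Finset.mul_sum]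
  refine Finset.sum_congr rfl fun c _ => ?_
  by_cases hc : x ∈ tsupport (P.toFun c)
  · rw [P.ratio_change hc hq hp' hq']; ring
  · simp [P.toFun_eq_zero hc]

theorem dbarMult_change {p p' q q' : Y × X} {y' : Y} {x : X} (hq : (y, x) ∈ L.base q)
    (hp' : (y', x) ∈ L.base p') (hq' : (y', x) ∈ L.base q') (ξ : EX) :
    P.dbarMult p p' y' x ξ =
      L.transition p q (y, x) * L.transition q' p' (y', x) * P.dbarMult q q' y' x ξ := by
  rw [dbarMult, dbarMult, Finset.mul_sum]
  refine Finset.sum_congr rfl fun c _ => ?_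
  by_cases hc : x ∈ tsupport (P.toFun c)
  · rw [P.ratio_change hc hq hp' hq']; ring
  · simp [P.dbar_toFun_eq_zero hc]

/-- The form `α` such that the holomorphic structure of `L_{y'}` is given by `∂̄ + α` on the
smooth bundle underlying `L_y`. -/
def form (y' : Y) (p : TangentBundle 𝓘(ℂ, EX) X) : ℂ :=
  P.dbarMult (y, p.1) (y', p.1) y' p.1 p.2 / P.mult (y, p.1) (y', p.1) y' p.1

/-- Numerator and denominator acquire the same nonzero factor under a change of frames, so the
quotient may be computed in any frames, in particular in fixed ones near a given point. -/
theorem form_eq {p p' : Y × X} {y' : Y} {x : X} (hp : (y, x) ∈ L.base p)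
    (hp' : (y', x) ∈ L.base p') (ξ : EX) :
    P.form y' ⟨x, ξ⟩ = P.dbarMult p p' y' x ξ / P.mult p p' y' x := by
  have hx := L.mem_base_self (y, x)
  have hx' := L.mem_base_self (y', x)
  rw [P.dbarMult_change (p := p) hx hp' hx', P.mult_change (p := p) hx hp' hx', form]
  refine (mul_div_mul_left _ _ (mul_ne_zero ?_ ?_)).symm
  · exact HolLineBundle.transition_ne_zero hp hx
  · exact HolLineBundle.transition_ne_zero hx' hp'

theorem contMDiffAt_real_mul {f g : X → ℂ} {x : X} (hf : ContMDiffAt 𝓘(ℝ, EX) 𝓘(ℝ, ℂ) ∞ f x)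
    (hg : ContMDiffAt 𝓘(ℝ, EX) 𝓘(ℝ, ℂ) ∞ g x) :
    ContMDiffAt 𝓘(ℝ, EX) 𝓘(ℝ, ℂ) ∞ (fun q => f q * g q) x :=
  ((ContinuousLinearMap.mul ℝ ℂ).contMDiff.contMDiffAt.comp x hf).clm_apply hg

theorem contMDiffAt_sum {ι : Type*} {s : Finset ι} {f : ι → X → ℂ} {x : X}
    (hf : ∀ i ∈ s, ContMDiffAt 𝓘(ℝ, EX) 𝓘(ℝ, ℂ) ∞ (f i) x) :
    ContMDiffAt 𝓘(ℝ, EX) 𝓘(ℝ, ℂ) ∞ (fun q => ∑ i ∈ s, f i q) x := by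
  have := contMDiffAt_finsetSum (I' := 𝓘(ℝ, EX)) (t := s) (f := f) (G := ℂ) hf
  exact this

/-- The Leibniz rule needs `g` to be regular only on the support: off it the product vanishes near
`x`. -/
theorem dbar_toFun_mul {g : X → ℂ} {c x : X}
    (hg : x ∈ tsupport (P.toFun c) → MDifferentiableAt 𝓘(ℝ, EX) 𝓘(ℝ, ℂ) g x) (ξ : EX) :
    dbar EX (fun q => P.toFun c q * g q) x ξ =
      P.toFun c x * dbar EX g x ξ + g x * dbar EX (P.toFun c) x ξ := by
  by_cases hc : x ∈ tsupport (P.toFun c)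
  · exact dbar_mul (P.mdifferentiableAt c x) (hg hc) ξ
  · have h1 : (fun q => P.toFun c q * g q) =ᶠ[𝓝 x] fun _ => 0 := by
      filter_upwards [P.toFun_eventuallyEq_zero hc] with q hq
      simp [hq]
    rw [dbar_congr h1, dbar_const, P.dbar_toFun_eq_zero hc, P.toFun_eq_zero hc]
    simp

theorem contMDiffAt_toFun_mul {g : X → ℂ} {c x : X}
    (hg : x ∈ tsupport (P.toFun c) → ContMDiffAt 𝓘(ℝ, EX) 𝓘(ℝ, ℂ) ∞ g x) :
    ContMDiffAt 𝓘(ℝ, EX) 𝓘(ℝ, ℂ) ∞ (fun q => P.toFun c q * g q) x := by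
  by_cases hc : x ∈ tsupport (P.toFun c)
  · exact contMDiffAt_real_mul (P.contMDiff c x) (hg hc)
  · refine (contMDiffAt_const (c := (0 : ℂ))).congr_of_eventuallyEq ?_
    filter_upwards [P.toFun_eventuallyEq_zero hc] with q hq
    simp [hq]

variable [IsManifold 𝓘(ℂ, EY) ω Y] [IsManifold 𝓘(ℂ, EX) ω X]

theorem contMDiffAt_ratio {p p' : Y × X} {y' : Y} {c x : X} (hc : x ∈ tsupport (P.toFun c))
    (hc' : (y', x) ∈ L.base (y, c)) (hp : (y, x) ∈ L.base p) (hp' : (y', x) ∈ L.base p') :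
    ContMDiffAt 𝓘(ℂ, EX) 𝓘(ℂ, ℂ) ω (P.ratio p p' y' c) x :=
  (HolLineBundle.contMDiffAt_transition hc' hp').slice.mul
    (HolLineBundle.contMDiffAt_transition hp (P.mem_base c x hc)).slice

theorem contMDiffAt_mult {p p' : Y × X} {y' : Y} {x : X} (hy' : P.Extends y' x)
    (hp : (y, x) ∈ L.base p) (hp' : (y', x) ∈ L.base p') :
    ContMDiffAt 𝓘(ℝ, EX) 𝓘(ℝ, ℂ) ∞ (P.mult p p' y') x :=
  contMDiffAt_sum fun c hcs => P.contMDiffAt_toFun_mul fun hc =>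
    (P.contMDiffAt_ratio hc (hy' c hcs hc) hp hp').restrictScalars_real.of_le le_top

/-- The ratios are holomorphic in `x`, so `∂̄` falls on the partition functions alone. -/
theorem dbar_mult {p p' : Y × X} {y' : Y} {x : X} (hy' : P.Extends y' x)
    (hp : (y, x) ∈ L.base p) (hp' : (y', x) ∈ L.base p') (ξ : EX) :
    dbar EX (P.mult p p' y') x ξ = P.dbarMult p p' y' x ξ := by
  have h1 : ∀ c ∈ P.centers, x ∈ tsupport (P.toFun c) →
      ContMDiffAt 𝓘(ℂ, EX) 𝓘(ℂ, ℂ) ω (P.ratio p p' y' c) x := fun c hcs hc =>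
    P.contMDiffAt_ratio hc (hy' c hcs hc) hp hp'
  have h2 : ∀ c ∈ P.centers, MDifferentiableAt 𝓘(ℝ, EX) 𝓘(ℝ, ℂ)
      (fun q => P.toFun c q * P.ratio p p' y' c q) x := fun c hcs =>
    (P.contMDiffAt_toFun_mul fun hc => (h1 c hcs hc).restrictScalars_real.of_le le_top).mdifferentiableAt
      (by simp)
  have h3 := dbar_sum h2 ξ
  rw [dbarMult, show P.mult p p' y' = _ from rfl]
  refine h3.trans (Finset.sum_congr rfl fun c hcs => ?_)
  rw [P.dbar_toFun_mul fun hc => (h1 c hcs hc).restrictScalars_real.mdifferentiableAt (by simp)]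
  by_cases hc : x ∈ tsupport (P.toFun c)
  · rw [dbar_of_holomorphic ((h1 c hcs hc).mdifferentiableAt (by simp))]
    ring
  · rw [P.toFun_eq_zero hc]
    ring

/-- In fixed frames the form is `∂̄A / A = ∂̄ log A`. Normalizing by the constant `A x` makes the
argument of the logarithm equal to `1` at `x`, hence in the slit plane nearby, without changing the
derivative. -/
theorem locallyExact_form {y' : Y} (hy' : P.Good y') : LocallyExact (P.form y') := by
  intro x
  have hx := L.mem_base_self (y, x)
  have hx' := L.mem_base_self (y', x)
  set A := P.mult (y, x) (y', x) y' with hA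
  have hA0 : A x ≠ 0 := (hy' x).2
  have hAx : ContMDiffAt 𝓘(ℝ, EX) 𝓘(ℝ, ℂ) ∞ A x := P.contMDiffAt_mult (hy' x).1 hx hx'
  have hF : ∀ z : ℂ, z / A x ∈ Complex.slitPlane →
      HasDerivAt (fun z => Complex.log (z / A x)) (z⁻¹) z := by
    intro z hz
    have h1 := ((hasDerivAt_id z).div_const (A x)).clog hz
    exact h1.congr_deriv ((div_div_div_cancel_right₀ hA0 1 z).trans (one_div z))
  have h1 : A x / A x ∈ Complex.slitPlane := by
    rw [div_self hA0]; exact Complex.one_mem_slitPlane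
  have hFs : ContDiffAt ℝ ∞ (fun z => Complex.log (z / A x)) (A x) := by
    have h2 : ContDiffAt ℂ ∞ (fun z => Complex.log (z / A x)) (A x) :=
      ContDiffAt.comp (f := fun z => z / A x) (A x) (Complex.contDiffAt_log h1)
        (contDiffAt_id.div_const (A x))
    exact h2.restrict_scalars ℝ
  refine ⟨fun q => Complex.log (A q / A x), hFs.contMDiffAt.comp x hAx, ?_⟩
  have h2 : ∀ᶠ q in 𝓝 x, A q / A x ∈ Complex.slitPlane :=
    (hAx.continuousAt.div_const (A x)).eventually_mem (Complex.isOpen_slitPlane.mem_nhds h1)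
  filter_upwards [h2, HermitianMetric.eventually_mem_base_slice hx,
    HermitianMetric.eventually_mem_base_slice hx'] with q h3 hq hq' ξ
  have hAq : ContMDiffAt 𝓘(ℝ, EX) 𝓘(ℝ, ℂ) ∞ A q := P.contMDiffAt_mult (hy' q).1 hq hq'
  refine (P.form_eq hq hq' ξ).trans ?_
  have h4 := dbar_comp (hAq.mdifferentiableAt (by simp)) (hF (A q) h3) ξ
  refine Eq.trans ?_ h4.symm
  exact (div_eq_inv_mul _ _).trans (congrArg _ (P.dbar_mult (hy' q).1 hq hq' ξ).symm)

end FramePartition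

namespace HolLineBundle

variable (L : HolLineBundle.{_, _, _, w} (𝓘(ℂ, EY).prod 𝓘(ℂ, EX)) (Y × X))

theorem frame_restrict {y : Y} {x q : X} (hq : (y, q) ∈ L.base (y, x)) :
    (L.restrict y).frame x q = L.frame (y, x) (y, q) := by
  have h := coeff_smul_frame (L := L.restrict y) (p := x) hq fun q => L.frame (y, x) (y, q)
  have h1 : (L.restrict y).coeff x (fun q => L.frame (y, x) (y, q)) q = 1 :=
    transition_self (L := L) hq
  rw [h1, one_smul] at h
  exact h

/-- The linear isomorphism from the fibre of `L` at `z` to `ℂ` given by the local frame. -/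
def fiberEquiv (p z : Y × X) (hz : z ∈ L.base p) : L.fiber z ≃ₗ[ℂ] ℂ :=
  (trivializationAt ℂ L.fiber p).linearEquivAt ℂ z hz

theorem fiberEquiv_symm_apply (p z : Y × X) (hz : z ∈ L.base p) (a : ℂ) :
    (L.fiberEquiv p z hz).symm a = a • L.frame p z := by
  have h : (L.fiberEquiv p z hz).symm 1 = L.frame p z := rfl
  rw [← h, ← map_smul, smul_eq_mul, mul_one]

theorem fiberEquiv_frame (p z : Y × X) (hz : z ∈ L.base p) :
    L.fiberEquiv p z hz (L.frame p z) = 1 := by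
  rw [← LinearEquiv.eq_symm_apply, fiberEquiv_symm_apply, one_smul]

end HolLineBundle

namespace FramePartition

variable {L : HolLineBundle.{_, _, _, w} (𝓘(ℂ, EY).prod 𝓘(ℂ, EX)) (Y × X)} {y : Y}
  (P : FramePartition L y)

/-- The fibrewise isomorphism from `L_y` to `L_{y'}` glued from the local frames. -/
def fiberIso {y' : Y} (hy' : P.Good y') (x : X) : L.fiber (y, x) ≃ₗ[ℂ] L.fiber (y', x) :=
  ((L.fiberEquiv (y, x) (y, x) (L.mem_base_self _)).trans
    (LinearEquiv.smulOfNeZero ℂ ℂ (P.mult (y, x) (y', x) y' x) (hy' x).2)).trans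
    (L.fiberEquiv (y', x) (y', x) (L.mem_base_self _)).symm

/-- The isomorphism is defined point by point in centred frames; `mult_change` shows that it has the
same shape in all frames, so that its coefficients can be differentiated. -/
theorem fiberIso_frame {y' : Y} (hy' : P.Good y') {p p' : Y × X} {x : X}
    (hp' : (y', x) ∈ L.base p') :
    P.fiberIso hy' x (L.frame p (y, x)) = P.mult p p' y' x • L.frame p' (y', x) := by
  have hx := L.mem_base_self (y, x)
  have hx' := L.mem_base_self (y', x)
  have h1 : P.fiberIso hy' x (L.frame (y, x) (y, x))
      = P.mult (y, x) (y', x) y' x • L.frame (y', x) (y', x) := by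
    simp [fiberIso, HolLineBundle.fiberEquiv_symm_apply, HolLineBundle.fiberEquiv_frame]
  rw [HolLineBundle.frame_eq (p := p) hx, map_smul, h1,
    HolLineBundle.frame_eq (p := (y', x)) hp', P.mult_change (p := p) hx hp' hx', smul_smul,
    smul_smul]
  congr 1
  ring

/-- The isomorphism `fiberIso`, on the fibres of the restricted bundles. -/
def restrictIso {y' : Y} (hy' : P.Good y') (q : X) :
    (L.restrict y).fiber q ≃ₗ[ℂ] (L.restrict y').fiber q :=
  P.fiberIso hy' q

theorem restrictIso_frame {y' : Y} (hy' : P.Good y') {x q : X} (hq : q ∈ (L.restrict y).base x)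
    (hq' : q ∈ (L.restrict y').base x) :
    P.restrictIso hy' q ((L.restrict y).frame x q)
      = P.mult (y, x) (y', x) y' q • (L.restrict y').frame x q := by
  rw [L.frame_restrict hq, L.frame_restrict hq']
  exact P.fiberIso_frame hy' hq'

theorem coeff_restrictIso {y' : Y} (hy' : P.Good y') {x q : X} (hq : q ∈ (L.restrict y).base x)
    (hq' : q ∈ (L.restrict y').base x) (s : ∀ q, (L.restrict y).fiber q) :
    (L.restrict y').coeff x (fun q => P.restrictIso hy' q (s q)) q
      = (L.restrict y).coeff x s q * P.mult (y, x) (y', x) y' q := by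
  refine HolLineBundle.coeff_eq_of_eq_smul hq' ?_
  rw [← HolLineBundle.coeff_smul_frame hq s, map_smul, P.restrictIso_frame hy' hq hq', smul_smul]

variable [IsManifold 𝓘(ℂ, EY) ω Y] [IsManifold 𝓘(ℂ, EX) ω X]

/-- Leibniz rule in a frame: `∂̄(sA) = (∂̄s + (∂̄A / A) s) A`. This is the intertwining relation of
`IsTwist` on coefficients. -/
theorem dbar_coeff_restrictIso {y' : Y} (hy' : P.Good y') {x : X} {s : ∀ q, (L.restrict y).fiber q}
    (hs : ContMDiffAt 𝓘(ℝ, EX) 𝓘(ℝ, ℂ) ∞ ((L.restrict y).coeff x s) x) (ξ : EX) :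
    dbar EX ((L.restrict y').coeff x fun q => P.restrictIso hy' q (s q)) x ξ
      = (dbar EX ((L.restrict y).coeff x s) x ξ + P.form y' ⟨x, ξ⟩ * (L.restrict y).coeff x s x)
        * P.mult (y, x) (y', x) y' x := by
  have hx := L.mem_base_self (y, x)
  have hx' := L.mem_base_self (y', x)
  have key : ((L.restrict y').coeff x fun q => P.restrictIso hy' q (s q)) =ᶠ[𝓝 x]
      fun q => (L.restrict y).coeff x s q * P.mult (y, x) (y', x) y' q := by
    filter_upwards [HermitianMetric.eventually_mem_base_slice hx,
      HermitianMetric.eventually_mem_base_slice hx'] with q hq hq'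
    exact P.coeff_restrictIso hy' hq hq' s
  have hA := P.contMDiffAt_mult (hy' x).1 hx hx'
  have hA0 := (hy' x).2
  rw [dbar_congr key, dbar_mul (hs.mdifferentiableAt (by simp)) (hA.mdifferentiableAt (by simp)),
    P.form_eq hx hx', P.dbar_mult (hy' x).1 hx hx']
  field_simp
  ring

theorem isTwist {y' : Y} (hy' : P.Good y') :
    (L.restrict y).IsTwist (L.restrict y') (P.locallyExact_form hy').toZ01 := by
  refine ⟨P.restrictIso hy', fun x => ?_, fun x s hs ξ => ?_⟩
  · have hx := L.mem_base_self (y, x)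
    have hx' := L.mem_base_self (y', x)
    refine (P.contMDiffAt_mult (hy' x).1 hx hx').congr_of_eventuallyEq ?_
    filter_upwards [HermitianMetric.eventually_mem_base_slice hx,
      HermitianMetric.eventually_mem_base_slice hx'] with q hq hq'
    have h2 : (L.restrict y).coeff x ((L.restrict y).frame x) q = 1 :=
      HolLineBundle.transition_self hq
    rw [P.coeff_restrictIso hy' hq hq', h2, one_mul]
  · have hx := (L.restrict y).mem_base_self x
    have hx' := (L.restrict y').mem_base_self x
    have hd := P.dbar_coeff_restrictIso hy' hs ξ
    rw [HolLineBundle.dbarSection, HolLineBundle.dbarSection]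
    refine (congrArg (· • (L.restrict y').frame x x) hd).trans ?_
    conv_rhs => rw [← HolLineBundle.coeff_smul_frame hx s]
    rw [smul_smul, ← add_smul, map_smul, P.restrictIso_frame hy' hx hx', smul_smul]
    rfl

theorem isExpTranslate {y' : Y} (hy' : P.Good y') :
    IsExpTranslate (L.inducedMap y) (dolbeaultClass (P.locallyExact_form hy').toZ01)
      (L.inducedMap y') :=
  ⟨L.restrict y, L.restrict y', _, rfl, rfl, rfl, P.isTwist hy'⟩

end FramePartition

end Trivialization

/-! ### Differentiation modulo a subspace of a topological vector space -/

section QuotientDerivative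

/-- Differentiability of a map into a quotient of a topological vector space, from a
differentiability estimate up to elements of the subspace. -/
theorem hasFDerivAt_mkQ {E V : Type*} [NormedAddCommGroup E] [NormedSpace ℂ E] [AddCommGroup V]
    [Module ℂ V] [TopologicalSpace V] [IsTopologicalAddGroup V] [ContinuousSMul ℂ V]
    (S : Submodule ℂ V) {f g : E → V} {T : E →ₗ[ℂ] V} {D : E →L[ℂ] V ⧸ S} {a₀ : E}
    (hD : ∀ v, D v = S.mkQ (T v)) (hg : ∀ v, g v ∈ S) (hf : f a₀ = 0)
    (h : Tendsto (fun a : E => ((‖a - a₀‖ : ℝ) : ℂ)⁻¹ • (f a - T (a - a₀) - g (a - a₀)))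
      (𝓝 a₀) (𝓝 0)) : HasFDerivAt (fun a => S.mkQ (f a)) D a₀ := by
  have key := (S.mkQL.continuous.tendsto 0).comp h
  rw [map_zero] at key
  -- The quotient carries no norm, so little-o is meant in the sense of topological vector spaces.
  -- Comparing with the scalar `‖a - a₀‖` turns it into convergence to `0` of the rescaled
  -- remainder, which is `key`.
  refine HasFDerivAt.of_isLittleOTVS ?_
  have hO : (fun a : E => ((‖a - a₀‖ : ℝ) : ℂ)) =O[ℂ; 𝓝 a₀] fun a => a - a₀ := by
    rw [Asymptotics.isBigOTVS_iff_isBigO]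
    refine Asymptotics.IsBigO.of_bound 1 (Eventually.of_forall fun a => ?_)
    simp
  refine Asymptotics.IsLittleOTVS.trans_isBigOTVS ?_ hO
  rw [Asymptotics.isLittleOTVS_iff_tendsto_inv_smul]
  · refine key.congr fun a => ?_
    -- The correction `g` need not be linear or continuous: it dies in the quotient.
    have h1 : S.mkQ (g (a - a₀)) = 0 := (Submodule.Quotient.mk_eq_zero _).2 (hg _)
    simp only [Function.comp_apply, Submodule.mkQL_apply, map_smul, map_sub (S.mkQ) (_ - _),
      map_sub S.mkQ (f a), h1, hf, map_zero, sub_zero, hD]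
  · refine Eventually.of_forall fun a ha => ?_
    have ha' : a = a₀ := by simpa [sub_eq_zero] using ha
    subst ha'
    simp

end QuotientDerivative

theorem tendsto_chart_symm {EY Y X : Type*} [NormedAddCommGroup EY] [TopologicalSpace Y]
    [ChartedSpace EY Y] [TopologicalSpace X] (y : Y) (x : X) :
    Tendsto (fun q : EY × X => ((chartAt EY y).symm q.1, q.2)) (𝓝 (chartAt EY y y) ×ˢ 𝓝 x)
      (𝓝 (y, x)) := by
  have h1 : Tendsto (chartAt EY y).symm (𝓝 (chartAt EY y y)) (𝓝 y) := by
    simpa using ((chartAt EY y).continuousAt_symm (mem_chart_target EY y)).tendsto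
  exact (h1.comp tendsto_fst).prodMk_nhds tendsto_snd

/-- Used with `d = ∂̄ρ_c`: as these sum to zero, `1` may be subtracted from every ratio, so that
each summand becomes small separately. -/
theorem sum_mul_sub_one_div_sub {ι : Type*} {s : Finset ι} {d : ι → ℂ} (hd : ∑ i ∈ s, d i = 0)
    (r f : ι → ℂ) (b : ℂ) :
    ∑ i ∈ s, d i * ((r i - 1) / b - f i) = (∑ i ∈ s, d i * r i) / b - ∑ i ∈ s, d i * f i := by
  have h1 : ∀ i, d i * ((r i - 1) / b - f i) = d i * r i / b - d i / b - d i * f i := fun i => by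
    ring
  simp only [h1, Finset.sum_sub_distrib, ← Finset.sum_div, hd, zero_div, sub_zero]

theorem locallyExact_dbar {EX X : Type*} [NormedAddCommGroup EX] [NormedSpace ℂ EX]
    [TopologicalSpace X] [ChartedSpace EX X] [IsManifold 𝓘(ℂ, EX) ω X] {f : X → ℂ} (hf : ContMDiff 𝓘(ℝ, EX) 𝓘(ℝ, ℂ) ∞ f) :
    LocallyExact (fun p : TangentBundle 𝓘(ℂ, EX) X => dbar EX f p.1 p.2) :=
  fun x => ⟨f, hf x, Eventually.of_forall fun _ _ => rfl⟩

/-! ### First order expansion of the transported form at `y` -/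

section Differential

universe w

variable {EY EX Y X : Type*} [NormedAddCommGroup EY] [NormedSpace ℂ EY]
  [NormedAddCommGroup EX] [NormedSpace ℂ EX]
  [TopologicalSpace Y] [ChartedSpace EY Y]
  [TopologicalSpace X] [ChartedSpace EX X]

namespace FramePartition

variable {L : HolLineBundle.{_, _, _, w} (𝓘(ℂ, EY).prod 𝓘(ℂ, EX)) (Y × X)} {y : Y}
  (P : FramePartition L y)

theorem ratio_self {p : Y × X} {c x : X} (hc : (y, x) ∈ L.base (y, c)) (hp : (y, x) ∈ L.base p) :
    P.ratio p p y c x = 1 :=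
  HolLineBundle.transition_mul_symm hc hp

theorem dbarMult_self {p : Y × X} {x : X} (hp : (y, x) ∈ L.base p) (ξ : EX) :
    P.dbarMult p p y x ξ = 0 := by
  rw [dbarMult, ← P.sum_dbar_toFun x ξ]
  refine Finset.sum_congr rfl fun c _ => ?_
  by_cases hc : x ∈ tsupport (P.toFun c)
  · rw [P.ratio_self (P.mem_base c x hc) hp, mul_one]
  · rw [P.dbar_toFun_eq_zero hc, zero_mul]

theorem contMDiffAt_ratio_prod {p : Y × X} {c x : X} (hc : x ∈ tsupport (P.toFun c))
    (hp : (y, x) ∈ L.base p) :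
    ContMDiffAt (𝓘(ℂ, EY).prod 𝓘(ℂ, EX)) 𝓘(ℂ, ℂ) ω
      (fun z : Y × X => P.ratio p p z.1 c z.2) (y, x) := by
  have h1 := HolLineBundle.contMDiffAt_transition (P.mem_base c x hc) hp
  have h2 := HolLineBundle.contMDiffAt_transition hp (P.mem_base c x hc)
  have h3 : ContMDiffAt (𝓘(ℂ, EY).prod 𝓘(ℂ, EX)) (𝓘(ℂ, EY).prod 𝓘(ℂ, EX)) ω
      (fun z : Y × X => (y, z.2)) (y, x) := contMDiffAt_const.prodMk contMDiffAt_snd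
  exact h1.mul (ContMDiffAt.comp (y, x) h2 h3)

theorem form_self (p : TangentBundle 𝓘(ℂ, EX) X) : P.form y p = 0 := by
  have h := P.dbarMult_self (L.mem_base_self (y, p.1)) p.2
  exact (congrArg (· / _) h).trans (zero_div _)

/-- At `(y, x)` the ratios whose partition function has `x` in its support equal `1`, and the
weights sum to `1`. The remaining terms vanish near `x`. -/
theorem tendsto_mult {p : Y × X} {x : X} (hp : (y, x) ∈ L.base p) :
    Tendsto (fun z : Y × X => P.mult p p z.1 z.2) (𝓝 (y, x)) (𝓝 1) := by
  rw [← P.sum_eq_one x]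
  refine tendsto_finsetSum _ fun c _ => ?_
  have hρ : Tendsto (fun z : Y × X => P.toFun c z.2) (𝓝 (y, x)) (𝓝 (P.toFun c x)) :=
    ((P.contMDiff c).continuous.comp continuous_snd).continuousAt
  by_cases hc : x ∈ tsupport (P.toFun c)
  · have h1 := hρ.mul (P.contMDiffAt_ratio_prod hc hp).continuousAt.tendsto
    simpa [P.ratio_self (P.mem_base c x hc) hp] using h1
  · rw [P.toFun_eq_zero hc]
    refine tendsto_const_nhds.congr' ?_
    filter_upwards [continuousAt_snd.eventually (P.toFun_eventuallyEq_zero hc)] with z hz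
    simp [hz]

variable [IsManifold 𝓘(ℂ, EX) ω X] [IsManifold 𝓘(ℂ, EY) ω Y]

/-- Each point `x` yields the condition on a neighbourhood of `(y, x)` in `Y × X`; compactness of
`X` makes the neighbourhood of `y` uniform. -/
theorem eventually_good [CompactSpace X] : ∀ᶠ y' in 𝓝 y, P.Good y' := by
  have h := isCompact_univ.eventually_forall_of_forall_eventually (x₀ := y)
    (K := (Set.univ : Set X))
    (P := fun y' x => P.Extends y' x ∧ P.mult (y, x) (y', x) y' x ≠ 0) fun x _ => ?_
  · exact h.mono fun y' hy' x => hy' x trivial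
  have hx := L.mem_base_self (y, x)
  have hext : ∀ᶠ z : Y × X in 𝓝 (y, x), P.Extends z.1 z.2 := by
    refine (Filter.eventually_all_finset _).2 fun c _ => ?_
    by_cases hc : x ∈ tsupport (P.toFun c)
    · have h2 : ∀ᶠ z in 𝓝 (y, x), z ∈ L.base (y, c) :=
        (L.isOpen_base _).mem_nhds (P.mem_base c x hc)
      exact h2.mono fun z hz _ => hz
    · have h2 : ∀ᶠ q in 𝓝 x, q ∉ tsupport (P.toFun c) :=
        (isClosed_tsupport _).isOpen_compl.mem_nhds hc
      exact (continuousAt_snd.eventually h2).mono fun z hz h3 => absurd h3 hz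
  have hmem : ∀ᶠ z : Y × X in 𝓝 (y, x), z ∈ L.base (y, x) := L.base_mem_nhds (y, x)
  have hmem' : ∀ᶠ z : Y × X in 𝓝 (y, x), (y, z.2) ∈ L.base (y, x) :=
    continuousAt_snd.eventually (HermitianMetric.eventually_mem_base_slice hx)
  filter_upwards [hext, hmem, hmem', (P.tendsto_mult hx).eventually_ne one_ne_zero]
    with z h1 h2 h3 h4
  -- `Good` refers to frames centred at the moving points. By `mult_change`, vanishing there would
  -- force vanishing in the fixed frame around `(y, x)`.
  refine ⟨h1, fun h5 => h4 ?_⟩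
  rw [P.mult_change (L.mem_base_self (y, z.2)) h2 (L.mem_base_self (z.1, z.2)), h5, mul_zero]

/-- The derivative of `ratio` at `y` in the direction of `Y`. -/
def fderivRatio (p : Y × X) (c x : X) : EY →L[ℂ] ℂ :=
  fderivY EY (fun z : Y × X => P.ratio p p z.1 c z.2) y x

/-- Dividing by `mult` does not affect first order: `ratio - 1` is already `O(a - a₀)`, and `mult⁻¹
- 1` tends to `0`. -/
theorem isLittleO_ratio {p : Y × X} {c x : X} (hc : x ∈ tsupport (P.toFun c))
    (hp : (y, x) ∈ L.base p) :
    (fun q : EY × X => (P.ratio p p ((chartAt EY y).symm q.1) c q.2 - 1)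
      / P.mult p p ((chartAt EY y).symm q.1) q.2 - P.fderivRatio p c q.2 (q.1 - chartAt EY y y))
      =o[𝓝 (chartAt EY y y) ×ˢ 𝓝 x] fun q => q.1 - chartAt EY y y := by
  have hF := P.contMDiffAt_ratio_prod hc hp
  have h1 : (fun q : EY × X => P.ratio p p ((chartAt EY y).symm q.1) c q.2 - 1
      - P.fderivRatio p c q.2 (q.1 - chartAt EY y y))
      =o[𝓝 (chartAt EY y y) ×ˢ 𝓝 x] fun q => q.1 - chartAt EY y y := by
    refine (isLittleO_sub_fderivY hF).congr' ?_ EventuallyEq.rfl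
    filter_upwards [tendsto_snd.eventually (HermitianMetric.eventually_mem_base_slice hp),
      tendsto_snd.eventually (HermitianMetric.eventually_mem_base_slice (P.mem_base c x hc))]
      with q h1 h2
    rw [P.ratio_self h2 h1]
    rfl
  have h2 : (fun q : EY × X => P.ratio p p ((chartAt EY y).symm q.1) c q.2 - 1)
      =O[𝓝 (chartAt EY y y) ×ˢ 𝓝 x] fun q => q.1 - chartAt EY y y := by
    refine (h1.isBigO.add (isBigO_fderivY hF (chartAt EY y y))).congr_left fun q => ?_
    exact sub_add_cancel _ _
  have h3 : Tendsto (fun q : EY × X => (P.mult p p ((chartAt EY y).symm q.1) q.2)⁻¹ - 1)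
      (𝓝 (chartAt EY y y) ×ˢ 𝓝 x) (𝓝 0) := by
    have h4 := (((P.tendsto_mult hp).comp (tendsto_chart_symm (EY := EY) y x)).inv₀ one_ne_zero).sub_const 1
    simpa using h4
  have h4 := h2.norm_right.mul_isLittleO ((Asymptotics.isLittleO_one_iff ℝ).2 h3)
  have h5 := Asymptotics.isLittleO_norm_right.1 (h4.congr_right fun q => mul_one _)
  refine (h5.add h1).congr_left fun q => ?_
  rw [div_eq_mul_inv]
  ring

variable (h : HermitianMetric L)

/-- With `e_c = g e_p`, the ratio is `g(y', x) / g(y, x)`, so its derivative at `y' = y` is the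
logarithmic derivative of `g` from the gauge change. -/
theorem chernFormY_eq_add_fderivRatio {p : Y × X} {c x : X} (hc : (y, x) ∈ L.base (y, c))
    (hp : (y, x) ∈ L.base p) (v : EY) :
    h.chernFormY (y, c) y v x = h.chernFormY p y v x + P.fderivRatio p c x v := by
  rw [h.chernFormY_eq_add hc hp]
  congr 1
  have h1 := (HolLineBundle.contMDiffAt_transition hc hp).differentiableAt_slice
  have h2 := fderiv_mul_const h1 (L.transition p (y, c) (y, x))
  rw [fderivRatio, fderivY, fderivY]
  unfold ratio
  rw [h2, smul_apply, smul_eq_mul, div_eq_iff (HolLineBundle.transition_ne_zero hc hp),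
    mul_right_comm, HolLineBundle.transition_mul_symm hp hc, one_mul]

/-- The primitive of the difference between the derivative of `form` and the contraction of the
curvature. -/
def correction (v : EY) (x : X) : ℂ :=
  ∑ c ∈ P.centers, P.toFun c x * h.chernFormY (y, c) y v x

theorem contMDiff_correction (v : EY) : ContMDiff 𝓘(ℝ, EX) 𝓘(ℝ, ℂ) ∞ (P.correction h v) :=
  fun x => contMDiffAt_sum fun c _ => P.contMDiffAt_toFun_mul fun hc =>
    h.contMDiffAt_chernFormY (P.mem_base c x hc) v

/-- Expand `∂̄(∑ ρ_c θ_c(v))` by Leibniz. The terms `ρ_c ∂̄θ_c(v)` sum to minus the contraction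
because `∑ ρ_c = 1`; in `∂̄ρ_c θ_c(v)` the part `θ_p(v)` common to all `c` drops out because `∑
∂̄ρ_c = 0`, leaving the derivatives of the ratios. -/
theorem contraction01_add_dbar_correction {p : Y × X} {x : X} (hp : (y, x) ∈ L.base p) (v : EY)
    (ξ : EX) : h.contraction01 y v x ξ + dbar EX (P.correction h v) x ξ
      = ∑ c ∈ P.centers, dbar EX (P.toFun c) x ξ * P.fderivRatio p c x v := by
  have h1 : dbar EX (P.correction h v) x ξ = ∑ c ∈ P.centers,
      (-(P.toFun c x * h.contraction01 y v x ξ) + h.chernFormY p y v x * dbar EX (P.toFun c) x ξ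
        + dbar EX (P.toFun c) x ξ * P.fderivRatio p c x v) := by
    have h2 : ∀ c ∈ P.centers, MDifferentiableAt 𝓘(ℝ, EX) 𝓘(ℝ, ℂ)
        (fun q => P.toFun c q * h.chernFormY (y, c) y v q) x := fun c _ =>
      (P.contMDiffAt_toFun_mul fun hc =>
        h.contMDiffAt_chernFormY (P.mem_base c x hc) v).mdifferentiableAt (by simp)
    refine (dbar_sum h2 ξ).trans (Finset.sum_congr rfl fun c _ => ?_)
    rw [P.dbar_toFun_mul fun hc =>
      (h.contMDiffAt_chernFormY (P.mem_base c x hc) v).mdifferentiableAt (by simp)]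
    by_cases hc : x ∈ tsupport (P.toFun c)
    · rw [h.contraction01_eq_neg_dbar (P.mem_base c x hc),
        P.chernFormY_eq_add_fderivRatio h (P.mem_base c x hc) hp]
      ring
    · rw [P.dbar_toFun_eq_zero hc, P.toFun_eq_zero hc]
      ring
  rw [h1, Finset.sum_add_distrib, Finset.sum_add_distrib, ← Finset.mul_sum, P.sum_dbar_toFun,
    Finset.sum_neg_distrib, ← Finset.sum_mul, P.sum_eq_one]
  ring

/-- The remainder is a finite sum of `∂̄ρ_c` times the remainders of `isLittleO_ratio`. The filter
is a product with `𝓝 p` because uniformity near `p` in `TX` is required for convergence in the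
compact-open topology. -/
theorem isLittleO_form (p : TangentBundle 𝓘(ℂ, EX) X) :
    (fun q : EY × TangentBundle 𝓘(ℂ, EX) X => P.form ((chartAt EY y).symm q.1) q.2
      - h.contraction01 y (q.1 - chartAt EY y y) q.2.1 q.2.2
      - dbar EX (P.correction h (q.1 - chartAt EY y y)) q.2.1 q.2.2)
      =o[𝓝 (chartAt EY y y) ×ˢ 𝓝 p] fun q => q.1 - chartAt EY y y := by
  obtain ⟨x, ξ⟩ := p
  set a₀ := chartAt EY y y with ha₀
  have hx := L.mem_base_self (y, x)
  have hproj : Tendsto (TotalSpace.proj : TangentBundle 𝓘(ℂ, EX) X → X) (𝓝 ⟨x, ξ⟩) (𝓝 x) :=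
    (FiberBundle.continuous_proj EX (TangentSpace 𝓘(ℂ, EX))).continuousAt
  have hpr : Tendsto (fun q : EY × TangentBundle 𝓘(ℂ, EX) X => (q.1, q.2.1))
      (𝓝 a₀ ×ˢ 𝓝 ⟨x, ξ⟩) (𝓝 a₀ ×ˢ 𝓝 x) := tendsto_fst.prodMk (hproj.comp tendsto_snd)
  have hterm : ∀ c ∈ P.centers, (fun q : EY × TangentBundle 𝓘(ℂ, EX) X =>
      dbar EX (P.toFun c) q.2.1 q.2.2 *
        ((P.ratio (y, x) (y, x) ((chartAt EY y).symm q.1) c q.2.1 - 1)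
          / P.mult (y, x) (y, x) ((chartAt EY y).symm q.1) q.2.1
          - P.fderivRatio (y, x) c q.2.1 (q.1 - a₀)))
      =o[𝓝 a₀ ×ˢ 𝓝 ⟨x, ξ⟩] fun q => q.1 - a₀ := by
    intro c _
    by_cases hc : x ∈ tsupport (P.toFun c)
    · have h1 := (P.isLittleO_ratio hc hx).comp_tendsto hpr
      have h2 : Tendsto (fun q : EY × TangentBundle 𝓘(ℂ, EX) X => dbar EX (P.toFun c) q.2.1 q.2.2)
          (𝓝 a₀ ×ˢ 𝓝 ⟨x, ξ⟩) (𝓝 (dbar EX (P.toFun c) x ξ)) :=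
        ((locallyExact_dbar (P.contMDiff c)).continuous.tendsto ⟨x, ξ⟩).comp tendsto_snd
      have h3 := (h2.isBigO_one ℝ).mul_isLittleO h1.norm_right
      exact Asymptotics.isLittleO_norm_right.1 (h3.congr_right fun q => one_mul _)
    · have h2 : ∀ᶠ q in 𝓝 x, q ∉ tsupport (P.toFun c) :=
        (isClosed_tsupport _).isOpen_compl.mem_nhds hc
      refine (Asymptotics.isLittleO_zero _ _).congr' ?_ EventuallyEq.rfl
      filter_upwards [(hproj.comp tendsto_snd).eventually h2] with q hq
      have h3 := P.dbar_toFun_eq_zero hq q.2.2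
      exact (mul_eq_zero_of_left h3 _).symm
  refine (Asymptotics.IsLittleO.sum hterm).congr' ?_ EventuallyEq.rfl
  have hm : ∀ᶠ z : Y × X in 𝓝 (y, x), z ∈ L.base (y, x) := L.base_mem_nhds (y, x)
  filter_upwards [(hproj.comp tendsto_snd).eventually (HermitianMetric.eventually_mem_base_slice hx),
    ((tendsto_chart_symm (EY := EY) y x).comp hpr).eventually hm] with q hq hq'
  have h1 := P.form_eq hq hq' q.2.2
  have h2 := P.contraction01_add_dbar_correction h hq (q.1 - a₀) q.2.2
  have h3 := P.sum_dbar_toFun q.2.1 q.2.2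
  rw [sub_sub]
  refine Eq.trans ?_ (congrArg₂ (· - ·) h1 h2).symm
  rw [Finset.sum_apply]
  exact sum_mul_sub_one_div_sub h3 _ _ _

open Classical in
/-- The family of forms `form y'`, in `Z^{0,1}(X)`. -/
def formZ01 (y' : Y) : Z01 EX X :=
  if hy' : P.Good y' then (P.locallyExact_form hy').toZ01 else 0

theorem formZ01_apply {y' : Y} (hy' : P.Good y') (p : TangentBundle 𝓘(ℂ, EX) X) :
    (P.formZ01 y').1 p = P.form y' p := by
  rw [formZ01, dif_pos hy']
  rfl

theorem formZ01_self : P.formZ01 y = 0 := by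
  by_cases hy : P.Good y
  · refine Subtype.ext (ContinuousMap.ext (X := TangentBundle 𝓘(ℂ, EX) X) (Y := ℂ) fun p => ?_)
    exact (P.formZ01_apply hy p).trans (P.form_self p)
  · rw [formZ01, dif_neg hy]

/-- `∂̄` of the correction, in `Z^{0,1}(X)`. -/
def correctionZ01 (v : EY) : Z01 EX X :=
  (locallyExact_dbar (P.contMDiff_correction h v)).toZ01

theorem correctionZ01_mem (v : EY) : P.correctionZ01 h v ∈ B01 EX X :=
  ⟨P.correction h v, P.contMDiff_correction h v, fun _ _ => rfl⟩

/-- Locally uniform convergence on `TX` implies convergence in the compact-open topology, and it can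
be checked along the product filters at each point, where it is `isLittleO_form` divided by `‖a -
a₀‖`. -/
theorem tendsto_formZ01 [CompactSpace X] :
    Tendsto (fun a : EY => ((‖a - chartAt EY y y‖ : ℝ) : ℂ)⁻¹ •
      (P.formZ01 ((chartAt EY y).symm a) - h.contractionMap y (a - chartAt EY y y)
        - P.correctionZ01 h (a - chartAt EY y y))) (𝓝 (chartAt EY y y)) (𝓝 0) := by
  rw [Topology.IsInducing.subtypeVal.tendsto_nhds_iff]
  refine ContinuousMap.tendsto_of_tendstoLocallyUniformly (α := TangentBundle 𝓘(ℂ, EX) X) (β := ℂ) ?_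
  rw [tendstoLocallyUniformly_iff_forall_tendsto]
  intro p
  rw [tendsto_uniformity_iff_dist_tendsto_zero]
  have h1 := (P.isLittleO_form h p).norm_norm.tendsto_div_nhds_zero
  refine h1.congr' ?_
  have hs : Tendsto (chartAt EY y).symm (𝓝 (chartAt EY y y)) (𝓝 y) := by
    simpa using ((chartAt EY y).continuousAt_symm (mem_chart_target EY y)).tendsto
  filter_upwards [(hs.comp tendsto_fst).eventually P.eventually_good] with q hq
  change _ = dist (0 : ℂ) (((‖q.1 - chartAt EY y y‖ : ℝ) : ℂ)⁻¹ *
    ((P.formZ01 ((chartAt EY y).symm q.1)).1 q.2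
      - h.contraction01 y (q.1 - chartAt EY y y) q.2.1 q.2.2
      - dbar EX (P.correction h (q.1 - chartAt EY y y)) q.2.1 q.2.2))
  refine Eq.trans ?_ (congrArg (fun t => dist (0 : ℂ) (_ * (t - _ - _)))
    (P.formZ01_apply hq q.2)).symm
  rw [dist_zero_left, norm_mul, norm_inv, Complex.norm_real, norm_norm,
    div_eq_inv_mul]
  rfl

end FramePartition

end Differential

end

/-! ### The differential of the induced map -/

theorem mainTheorem11 {EY EX Y X : Type*}
    [NormedAddCommGroup EY] [NormedSpace ℂ EY] [FiniteDimensional ℂ EY]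
    [NormedAddCommGroup EX] [NormedSpace ℂ EX] [FiniteDimensional ℂ EX]
    [TopologicalSpace Y] [T2Space Y] [ChartedSpace EY Y] [IsManifold 𝓘(ℂ, EY) ω Y]
    [TopologicalSpace X] [T2Space X] [ChartedSpace EX X] [IsManifold 𝓘(ℂ, EX) ω X]
    [CompactSpace X]
    (L : HolLineBundle (𝓘(ℂ, EY).prod 𝓘(ℂ, EX)) (Y × X)) (h : HermitianMetric L) (y : Y) :
    ∃ D : TangentSpace 𝓘(ℂ, EY) y →L[ℂ] H01 EX X,
      HasPicDifferentialAt L.inducedMap y D ∧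
      ∀ v : TangentSpace 𝓘(ℂ, EY) y, ∃ α : Z01 EX X,
        (∀ (x : X) (ξ : TangentSpace 𝓘(ℂ, EX) x), α.1 ⟨x, ξ⟩ = h.contraction01 y v x ξ) ∧
        D v = dolbeaultClass α := by
  obtain ⟨P⟩ := exists_framePartition L y
  -- Continuity is automatic, the source being finite dimensional.
  let D : EY →L[ℂ] H01 EX X :=
    LinearMap.toContinuousLinearMap ((B01 EX X).mkQ ∘ₗ h.contractionMap y)
  -- The local lift of the induced map through `exp` is the class of the transported form.
  refine ⟨D, ⟨fun y' => dolbeaultClass (P.formZ01 y'), ?_, ?_, ?_⟩, fun v =>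
    ⟨h.contractionMap y v, fun _ _ => rfl, rfl⟩⟩
  · exact congrArg dolbeaultClass P.formZ01_self
  · filter_upwards [P.eventually_good] with y' hy'
    rw [FramePartition.formZ01, dif_pos hy']
    exact P.isExpTranslate hy'
  · exact hasFDerivAt_mkQ (B01 EX X) (f := fun a => P.formZ01 ((chartAt EY y).symm a))
      (T := h.contractionMap y) (fun _ => rfl) (P.correctionZ01_mem h)
      ((congrArg P.formZ01 ((chartAt EY y).left_inv (mem_chart_source EY y))).trans
        P.formZ01_self)
      (P.tendsto_formZ01 h)
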